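/- **Setting.** Let $k$ be a field and let $R$ be a discrete valuation ring which is a $k$-algebra, with maximal ideal $XR$ and residue field $R/XR=k$ (that is, the natural map $k\to R/XR$ is an isomorphism). Let $\alpha$ be a $k$-algebra automorphism of $R$ of infinite order, let $S=R[\theta;\alpha]$ be the skew polynomial ring (with $\theta r=\alpha(r)\theta$ for $r\in R$), and let $T=Q[\theta;\alpha]=S\langle X^{-1}\rangle$, where $Q$ is the field of fractions of $R$; thus $T$ is the localisation of $S$ at the powers of $X$. An element of a ring is irreducible if it is a nonzero non-unit and, whenever it is written as $ab$, one of $a,b$ is a unit. An irreducible element $w$ of $S$ is of type **(B)** if $w=1+Xs$ with $s\in S\setminus R$. An irreducible element $z$ of $S$ is of type **(C)** if $z\neq\theta$ and $z=f+Xs$ with $f\in k[\theta]\setminus k$ monic and $s\in S$. The ring $S$ satisfies right $(\diamond)$ if the injective hull of every simple right $S$-module is locally Artinian, i.e. all its finitely generated submodules are Artinian. **Theorem.** 1. Let $w$ and $z$ be irreducible elements of $S$, with $w$ of type (B) and $z$ of type (C). Then the following are equivalent: - (a) $\mathrm{Ext}^1_S(S/zS,\,S/wS)=0$ (right modules); -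 (b) $\mathrm{Ext}^1_S(S/Sw,\,S/Sz)=0$ (left modules); - (c) $\mathrm{Ext}^1_T(T/zT,\,T/wT)=0$ (right modules); - (d) $\mathrm{Ext}^1_T(T/Tw,\,T/Tz)=0$ (left modules). 2. $S$ satisfies right $(\diamond)$ if and only if the equivalent statements in (1) hold for all such elements $z$ and $w$. -/

import Mathlib

open CategoryTheory

universe u v

noncomputable section

/-! ### Skew polynomial rings `A[θ; σ]` -/

/-- The action of the monoid `ℕ` on `A` in which `n` acts as `σ ^ n`. -/
abbrev skewAction {A : Type u} [Ring A] (σ : A ≃+* A) :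
    MulSemiringAction (Multiplicative ℕ) A :=
  MulSemiringAction.compHom A (powersHom (A ≃+* A) σ)

/-- The skew polynomial ring `A[θ; σ]`: left polynomials `∑ aₙ θⁿ`, multiplied according to the
rule `θ a = σ(a) θ`. -/
def SkewPoly {A : Type u} [Ring A] (_ : A ≃+* A) : Type u := SkewPolynomial A

namespace SkewPoly

variable {A : Type u} [Ring A] (σ : A ≃+* A)

instance : Ring (SkewPoly σ) :=
  letI := skewAction σ
  inferInstanceAs (Ring (SkewPolynomial A))

/-- The embedding of the coefficient ring `A` in `A[θ; σ]`. -/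
def C : A →+* SkewPoly σ :=
  letI := skewAction σ
  (SkewPolynomial.CRingHom : A →+* SkewPolynomial A)

/-- The variable `θ` of `A[θ; σ]`. -/
def θ : SkewPoly σ := (SkewPolynomial.X : SkewPolynomial A)

theorem C_mul_θ_pow (a : A) (n : ℕ) :
    C σ a * θ σ ^ n = (SkewPolynomial.monomial n a : SkewPolynomial A) :=
  let _ := skewAction σ
  SkewPolynomial.C_mul_X_pow_eq_monomial (R := A) (a := a) (n := n)

theorem θ_mul_C (a : A) : θ σ * C σ a = C σ (σ a) * θ σ :=
  let _ := skewAction σ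
  (SkewPolynomial.X_mul_monomial (R := A) 0 a).trans
    (SkewPolynomial.monomial_mul_X (R := A) 0 (σ a)).symm

theorem θ_pow_mul_C (n : ℕ) (a : A) : θ σ ^ n * C σ a = C σ ((σ ^ n) a) * θ σ ^ n := by
  induction n generalizing a with
  | zero => simp
  | succ n ih => rw [pow_succ, mul_assoc, θ_mul_C, ← mul_assoc, ih, mul_assoc, pow_succ]; rfl

/-- Every element of `A[θ; σ]` is a sum of monomials `a θⁿ`. -/
theorem induction_on {motive : SkewPoly σ → Prop} (p : SkewPoly σ) (h0 : motive 0)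
    (hmon : ∀ (a : A) (n : ℕ), motive (C σ a * θ σ ^ n))
    (hadd : ∀ p q, motive p → motive q → motive (p + q)) : motive p :=
  SkewPolynomial.induction (motive := motive) p h0 fun n r _ _ _ hq ↦
    hadd _ _ (C_mul_θ_pow σ r n ▸ hmon r n) hq

variable {σ}

/-- The ring homomorphism `A[θ; σ] → B[θ; τ]`, `∑ aₙ θⁿ ↦ ∑ f(aₙ) θⁿ`, induced by a ring
homomorphism `f : A → B` with `f ∘ σ = τ ∘ f`. -/
def map {B : Type u} [Ring B] {τ : B ≃+* B} (f : A →+* B) (hf : ∀ a, f (σ a) = τ (f a)) :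
    SkewPoly σ →+* SkewPoly τ :=
  letI := skewAction σ
  SkewMonoidAlgebra.liftNCRingHom (k := A) (G := Multiplicative ℕ) ((C τ).comp f)
    (powersHom _ (θ τ)) (by
      intro a n
      have key : ∀ m : ℕ, f ((σ ^ m) a) = (τ ^ m) (f a) := by
        intro m
        induction m with
        | zero => rfl
        | succ m ih =>
          rw [pow_succ', pow_succ']
          exact (hf _).trans (congrArg τ ih)
      exact ((θ_pow_mul_C τ n.toAdd (f a)).trans
        (congrArg (fun b ↦ C τ b * θ τ ^ n.toAdd) (key n.toAdd).symm)).symm)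

theorem map_C_mul_θ_pow {B : Type u} [Ring B] {τ : B ≃+* B} (f : A →+* B)
    (hf : ∀ a, f (σ a) = τ (f a)) (a : A) (n : ℕ) :
    map f hf (C σ a * θ σ ^ n) = C τ (f a) * θ τ ^ n := by
  let _ := skewAction σ
  rw [C_mul_θ_pow]
  exact SkewMonoidAlgebra.liftNC_single _ _ _ _

theorem map_injective {B : Type u} [Ring B] {τ : B ≃+* B} (f : A →+* B)
    (hf : ∀ a, f (σ a) = τ (f a)) (hinj : Function.Injective f) :
    Function.Injective (map f hf : SkewPoly σ → SkewPoly τ) := by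
  have key : ∀ (p : SkewPoly σ) (m : ℕ),
      SkewPolynomial.coeff (R := B) (map f hf p : SkewPoly τ) m =
        f (SkewPolynomial.coeff (R := A) p m) := by
    intro p m
    induction p using induction_on with
    | h0 => exact (congrArg (SkewPolynomial.coeff (R := B) · m)
        (map_zero (map f hf : SkewPoly σ →+* SkewPoly τ))).trans (map_zero f).symm
    | hmon a n =>
      rw [map_C_mul_θ_pow, C_mul_θ_pow, C_mul_θ_pow, SkewPolynomial.coeff_monomial,
        SkewPolynomial.coeff_monomial]
      split_ifs <;> simp
    | hadd p q hp hq =>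
      rw [map_add]
      exact (SkewPolynomial.coeff_add (R := B) _ _ m).trans <| (congrArg₂ (· + ·) hp hq).trans <|
        (map_add f _ _).symm.trans (congrArg f (SkewPolynomial.coeff_add (R := A) p q m).symm)
  intro p q hpq
  have h : ∀ m, SkewPolynomial.coeff (R := A) p m = SkewPolynomial.coeff (R := A) q m := fun m ↦
    hinj ((key p m).symm.trans ((congrArg (SkewPolynomial.coeff (R := B) · m) hpq).trans (key q m)))
  exact SkewMonoidAlgebra.ext fun m ↦ h m.toAdd

end SkewPoly

/-! ### The rings `S = R[θ; α]` and `T = Q[θ; α]` -/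

section Rings

variable {k : Type v} {R : Type u} [Field k] [CommRing R] [Algebra k R]

/-- `S = R[θ; α]`. -/
abbrev RingS (α : R ≃ₐ[k] R) : Type u := SkewPoly (α : R ≃+* R)

/-- The extension of `α` to the field of fractions `Q` of `R`. -/
def fracAut (α : R ≃ₐ[k] R) : FractionRing R ≃+* FractionRing R :=
  IsFractionRing.ringEquivOfRingEquiv (α : R ≃+* R)

theorem fracAut_algebraMap (α : R ≃ₐ[k] R) (r : R) :
    algebraMap R (FractionRing R) ((α : R ≃+* R) r) =
      fracAut α (algebraMap R (FractionRing R) r) :=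
  (IsFractionRing.ringEquivOfRingEquiv_algebraMap (α : R ≃+* R) r).symm

/-- `T = Q[θ; α]` with `Q` the field of fractions of `R`. When `R` is a discrete valuation ring
with uniformizer `X`, this is the localization of `S` at the powers of `X`: see
`toT_injective`, `isUnit_toT_X`, `exists_X_pow_mul_eq_toT` and `exists_mul_X_pow_eq_toT`. -/
abbrev RingT (α : R ≃ₐ[k] R) : Type u := SkewPoly (fracAut α)

/-- The inclusion `S → T`. -/
def toT (α : R ≃ₐ[k] R) : RingS α →+* RingT α :=
  SkewPoly.map (algebraMap R (FractionRing R)) (fracAut_algebraMap α)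

/-- The element `r` of the coefficient ring `R`, viewed in `S`. -/
abbrev constS (α : R ≃ₐ[k] R) (r : R) : RingS α := SkewPoly.C (α : R ≃+* R) r

theorem toT_injective (α : R ≃ₐ[k] R) : Function.Injective (toT α) :=
  SkewPoly.map_injective _ _ (IsFractionRing.injective R (FractionRing R))

theorem toT_constS_mul (α : R ≃ₐ[k] R) (r : R) (n : ℕ) :
    toT α (constS α r * SkewPoly.θ _ ^ n) =
      SkewPoly.C (fracAut α) (algebraMap R _ r) * SkewPoly.θ _ ^ n :=
  SkewPoly.map_C_mul_θ_pow _ _ _ _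

theorem toT_constS (α : R ≃ₐ[k] R) (r : R) :
    toT α (constS α r) = SkewPoly.C (fracAut α) (algebraMap R _ r) := by
  simpa using toT_constS_mul α r 0

theorem isUnit_toT_X [IsDomain R] (α : R ≃ₐ[k] R) {X : R} (hX : X ≠ 0) : IsUnit (toT α (constS α X)) := by
  rw [toT_constS]
  exact (IsUnit.mk0 _ (by simpa using hX)).map _

/-- Every element of `Q` has the form `X⁻ⁿ r`. -/
theorem exists_X_pow_mul_eq_algebraMap [IsDomain R] [IsDiscreteValuationRing R] {X : R}
    (hX : IsLocalRing.maximalIdeal R = Ideal.span {X}) (a : FractionRing R) :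
    ∃ (n : ℕ) (r : R), algebraMap R (FractionRing R) X ^ n * a = algebraMap R _ r := by
  obtain ⟨x, y, hy, rfl⟩ := IsFractionRing.div_surjective (A := R) a
  have hX' : Irreducible X := (IsDiscreteValuationRing.irreducible_iff_uniformizer X).2 hX
  have hy0 : y ≠ 0 := nonZeroDivisors.ne_zero hy
  obtain ⟨n, u, rfl⟩ := IsDiscreteValuationRing.eq_unit_mul_pow_irreducible hy0 hX'
  refine ⟨n, ↑u⁻¹ * x, ?_⟩
  have h1 : algebraMap R (FractionRing R) (u * X ^ n) ≠ 0 := by simpa using hy0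
  field_simp
  rw [← map_pow, ← map_mul, ← map_mul]
  congr 1
  calc X ^ n * x = (u * ↑u⁻¹ : R) * (X ^ n * x) := by simp
    _ = _ := by ring

/-- Every element of `T` has the form `X⁻ⁿ s` with `s ∈ S`. -/
theorem exists_X_pow_mul_eq_toT [IsDomain R] [IsDiscreteValuationRing R] (α : R ≃ₐ[k] R) {X : R}
    (hX : IsLocalRing.maximalIdeal R = Ideal.span {X}) (t : RingT α) :
    ∃ (n : ℕ) (s : RingS α), toT α (constS α X) ^ n * t = toT α s := by
  induction t using SkewPoly.induction_on with
  | h0 => exact ⟨0, 0, by simp⟩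
  | hmon a m =>
    obtain ⟨n, r, h⟩ := exists_X_pow_mul_eq_algebraMap hX a
    refine ⟨n, constS α r * SkewPoly.θ _ ^ m, ?_⟩
    rw [toT_constS_mul, ← h, toT_constS, map_mul, map_pow, mul_assoc]
  | hadd p q hp hq =>
    obtain ⟨n, s, hs⟩ := hp
    obtain ⟨m, s', hs'⟩ := hq
    refine ⟨n + m, constS α X ^ m * s + constS α X ^ n * s', ?_⟩
    rw [map_add, map_mul, map_mul, map_pow, map_pow, ← hs, ← hs', ← mul_assoc, ← mul_assoc,
      ← pow_add, ← pow_add, mul_add, add_comm m n]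

/-- `X` is a normal element of `S`: `S X ⊆ X S`. -/
theorem exists_mul_X_eq [IsDomain R] [IsDiscreteValuationRing R] (α : R ≃ₐ[k] R) {X : R}
    (hX : IsLocalRing.maximalIdeal R = Ideal.span {X}) (s : RingS α) :
    ∃ s' : RingS α, s * constS α X = constS α X * s' := by
  have hX' : Irreducible X := (IsDiscreteValuationRing.irreducible_iff_uniformizer X).2 hX
  induction s using SkewPoly.induction_on with
  | h0 => exact ⟨0, by simp⟩
  | hmon a n =>
    have hα : Irreducible (((α : R ≃+* R) ^ n) X) := (MulEquiv.irreducible_iff _).2 hX'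
    obtain ⟨u, hu⟩ := IsDiscreteValuationRing.associated_of_irreducible R hX' hα
    refine ⟨constS α (u * a) * SkewPoly.θ _ ^ n, ?_⟩
    rw [mul_assoc, SkewPoly.θ_pow_mul_C, ← mul_assoc, ← mul_assoc, ← map_mul, ← map_mul,
      ← mul_assoc, hu, mul_comm a]
  | hadd p q hp hq =>
    obtain ⟨p', hp⟩ := hp
    obtain ⟨q', hq⟩ := hq
    exact ⟨p' + q', by rw [mul_add, add_mul, hp, hq]⟩

/-- Every element of `T` has the form `s X⁻ⁿ` with `s ∈ S`. -/
theorem exists_mul_X_pow_eq_toT [IsDomain R] [IsDiscreteValuationRing R] (α : R ≃ₐ[k] R) {X : R}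
    (hX : IsLocalRing.maximalIdeal R = Ideal.span {X}) (t : RingT α) :
    ∃ (n : ℕ) (s : RingS α), t * toT α (constS α X) ^ n = toT α s := by
  have hX0 : X ≠ 0 :=
    ((IsDiscreteValuationRing.irreducible_iff_uniformizer X).2 hX).ne_zero
  obtain ⟨n, s, h⟩ := exists_X_pow_mul_eq_toT α hX t
  have key : ∀ (m : ℕ) (s : RingS α), ∃ s' : RingS α,
      s * constS α X ^ m = constS α X ^ m * s' := by
    intro m
    induction m with
    | zero => exact fun s ↦ ⟨s, by simp⟩
    | succ m ih =>
      intro s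
      obtain ⟨s', h'⟩ := ih s
      obtain ⟨s'', h''⟩ := exists_mul_X_eq α hX s'
      exact ⟨s'', by rw [pow_succ, ← mul_assoc, h', mul_assoc, h'', mul_assoc]⟩
  obtain ⟨s', hs'⟩ := key n s
  refine ⟨n, s', ((isUnit_toT_X α hX0).pow n).mul_left_cancel ?_⟩
  rw [← mul_assoc, h, ← map_pow, ← map_mul, ← map_mul, hs']

/-- The embedding `k[θ] → S`, `∑ cₙ θⁿ ↦ ∑ cₙ θⁿ`. -/
def polyToS (α : R ≃ₐ[k] R) (f : Polynomial k) : RingS α :=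
  f.eval₂ ((SkewPoly.C (α : R ≃+* R)).comp (algebraMap k R)) (SkewPoly.θ (α : R ≃+* R))

/-- Irreducible elements of `S` of type (B): `w = 1 + X s` with `s ∈ S \ R`. -/
def IsTypeB (α : R ≃ₐ[k] R) (X : R) (w : RingS α) : Prop :=
  Irreducible w ∧ ∃ s : RingS α, s ∉ Set.range (constS α) ∧ w = 1 + constS α X * s

/-- Irreducible elements of `S` of type (C): `z = f + X s` with `f ∈ k[θ] \ k` monic, `s ∈ S`,
and `z ≠ θ`. -/
def IsTypeC (α : R ≃ₐ[k] R) (X : R) (z : RingS α) : Prop :=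
  Irreducible z ∧ z ≠ SkewPoly.θ (α : R ≃+* R) ∧
    ∃ (f : Polynomial k) (s : RingS α), f.Monic ∧ f ∉ Set.range (Polynomial.C : k → Polynomial k) ∧
      z = polyToS α f + constS α X * s

end Rings

/-! ### Cyclic modules, `Ext¹`, injective hulls and property (⋄).
Right modules over `A` are modules over the opposite ring `Aᵐᵒᵖ`. -/

/-- The right module `A / aA`. -/
abbrev rightCyclic {A : Type u} [Ring A] (a : A) : ModuleCat.{u} Aᵐᵒᵖ :=
  ModuleCat.of Aᵐᵒᵖ (A ⧸ Submodule.span Aᵐᵒᵖ {a})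

/-- The left module `A / Aa`. -/
abbrev leftCyclic {A : Type u} [Ring A] (a : A) : ModuleCat.{u} A :=
  ModuleCat.of A (A ⧸ Submodule.span A {a})

/-- `Ext¹_A(M, N) = 0`. -/
def ExtOneVanishes {A : Type u} [Ring A] (M N : ModuleCat.{u} A) : Prop :=
  Subsingleton (Abelian.Ext M N 1)

/-- `ι : V → E` is an injective hull: `E` is injective, `ι` is a monomorphism, and `E` is an
essential extension of the image of `ι`. -/
structure IsInjectiveHull {A : Type u} [Ring A] {V E : Type u} [AddCommGroup V] [Module A V]
    [AddCommGroup E] [Module A E] (ι : V →ₗ[A] E) : Prop where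
  injective_module : Module.Injective A E
  injective_map : Function.Injective ι
  essential : ∀ N : Submodule A E, N ⊓ LinearMap.range ι = ⊥ → N = ⊥

/-- Every finitely generated submodule is Artinian. -/
def IsLocallyArtinian (A : Type u) [Ring A] (E : Type u) [AddCommGroup E] [Module A E] : Prop :=
  ∀ N : Submodule A E, N.FG → IsArtinian A N

/-- Right (⋄): the injective hulls of the simple right `A`-modules are locally Artinian. -/
def RightDiamond (A : Type u) [Ring A] : Prop :=
  ∀ (V E : Type u) [AddCommGroup V] [Module Aᵐᵒᵖ V] [AddCommGroup E] [Module Aᵐᵒᵖ E]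
    (ι : V →ₗ[Aᵐᵒᵖ] E), IsSimpleModule Aᵐᵒᵖ V → IsInjectiveHull ι → IsLocallyArtinian Aᵐᵒᵖ E

end

open scoped RightActions

noncomputable section

namespace SkewPoly

section Coeff

variable {A : Type u} [Ring A] {σ : A ≃+* A}

/-- The coefficient of `θ ^ n` in a skew polynomial, as an additive map. -/
def coeff (n : ℕ) : SkewPoly σ →+ A where
  toFun p := SkewPolynomial.coeff (R := A) p n
  map_zero' := rfl
  map_add' p q := SkewPolynomial.coeff_add (R := A) p q n

@[ext]
theorem ext {p q : SkewPoly σ} (h : ∀ n, coeff n p = coeff n q) : p = q :=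
  SkewPolynomial.ext (R := A) h

theorem coeff_C_mul_θ_pow (a : A) (m n : ℕ) :
    coeff n (C σ a * θ σ ^ m) = if m = n then a else 0 :=
  (congrArg (SkewPolynomial.coeff (R := A) · n) (C_mul_θ_pow σ a m)).trans
    SkewPolynomial.coeff_monomial

theorem coeff_C (a : A) (n : ℕ) : coeff n (C σ a) = if 0 = n then a else 0 := by
  simpa using coeff_C_mul_θ_pow (σ := σ) a 0 n

theorem coeff_θ (n : ℕ) : coeff n (θ σ) = if 1 = n then 1 else 0 := by
  simpa using coeff_C_mul_θ_pow (σ := σ) 1 1 n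

theorem C_injective : Function.Injective (C σ) := fun a b h ↦ by
  simpa [coeff_C] using congrArg (coeff 0) h

theorem coeff_mul (p q : SkewPoly σ) (n : ℕ) :
    coeff n (p * q) =
      ∑ x ∈ Finset.HasAntidiagonal.antidiagonal n, coeff x.1 p * (σ ^ x.1) (coeff x.2 q) := by
  induction p using induction_on with
  | h0 => simp
  | hadd p p' hp hp' => simp [add_mul, hp, hp', Finset.sum_add_distrib]
  | hmon a i =>
    induction q using induction_on with
    | h0 => simp
    | hadd q q' hq hq' => simp [mul_add, hq, hq', Finset.sum_add_distrib]
    | hmon b j =>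
      have h : C σ a * θ σ ^ i * (C σ b * θ σ ^ j) = C σ (a * (σ ^ i) b) * θ σ ^ (i + j) := by
        rw [mul_assoc, ← mul_assoc (θ σ ^ i), θ_pow_mul_C, map_mul, pow_add]
        simp only [mul_assoc]
      rw [h, coeff_C_mul_θ_pow]
      simp only [coeff_C_mul_θ_pow]
      split_ifs with hn
      · rw [Finset.sum_eq_single (i, j)]
        · simp
        · rintro ⟨x, y⟩ - hxy
          by_cases hx : i = x
          · by_cases hy : j = y
            · exact absurd (by rw [hx, hy]) hxy
            · simp [hy]
          · simp [hx]
        · intro h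
          exact absurd (Finset.HasAntidiagonal.mem_antidiagonal.2 hn) h
      · rw [Finset.sum_eq_zero]
        rintro ⟨x, y⟩ hxy
        have := Finset.HasAntidiagonal.mem_antidiagonal.1 hxy
        by_cases hx : i = x
        · by_cases hy : j = y
          · subst hx hy; exact absurd this hn
          · simp [hy]
        · simp [hx]

theorem coeff_mul_C (a : A) (p : SkewPoly σ) (n : ℕ) :
    coeff n (p * C σ a) = coeff n p * (σ ^ n) a := by
  rw [coeff_mul, Finset.sum_eq_single (n, 0)]
  · simp [coeff_C]
  · rintro ⟨x, y⟩ hxy hne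
    have h1 := Finset.HasAntidiagonal.mem_antidiagonal.1 hxy
    have : y ≠ 0 := by rintro rfl; exact hne (by simpa using h1)
    simp [coeff_C, this.symm]
  · simp

theorem coeff_mul_θ_succ (p : SkewPoly σ) (n : ℕ) : coeff (n + 1) (p * θ σ) = coeff n p := by
  rw [coeff_mul, Finset.sum_eq_single (n, 1)]
  · simp [coeff_θ]
  · rintro ⟨x, y⟩ hxy hne
    have h1 := Finset.HasAntidiagonal.mem_antidiagonal.1 hxy
    have : y ≠ 1 := by rintro rfl; exact hne (by simpa using h1)
    simp [coeff_θ, this.symm]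
  · simp

theorem exists_coeff_eq_zero (p : SkewPoly σ) : ∃ n, ∀ m ≥ n, coeff m p = 0 := by
  induction p using induction_on with
  | h0 => exact ⟨0, by simp⟩
  | hmon a n => exact ⟨n + 1, fun m hm ↦ by rw [coeff_C_mul_θ_pow, if_neg (by omega)]⟩
  | hadd p q hp hq =>
    obtain ⟨n, hn⟩ := hp
    obtain ⟨m, hm⟩ := hq
    exact ⟨max n m, fun l hl ↦ by
      rw [map_add, hn l (le_trans (le_max_left _ _) hl), hm l (le_trans (le_max_right _ _) hl),
        add_zero]⟩

open Classical in
/-- The least `n` such that all coefficients in degrees `≥ n` vanish: it is `0` for `p = 0` and the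
degree plus one for `p ≠ 0`. -/
def degSucc (p : SkewPoly σ) : ℕ := Nat.find (exists_coeff_eq_zero p)

open Classical in
theorem coeff_eq_zero_of_degSucc_le {p : SkewPoly σ} {m : ℕ} (h : degSucc p ≤ m) :
    coeff m p = 0 :=
  Nat.find_spec (exists_coeff_eq_zero p) m h

open Classical in
theorem degSucc_le_iff {p : SkewPoly σ} {n : ℕ} : degSucc p ≤ n ↔ ∀ m ≥ n, coeff m p = 0 :=
  ⟨fun h _ hm ↦ coeff_eq_zero_of_degSucc_le (h.trans hm), fun h ↦ Nat.find_min' _ h⟩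

@[simp]
theorem degSucc_eq_zero {p : SkewPoly σ} : degSucc p = 0 ↔ p = 0 := by
  rw [← Nat.le_zero, degSucc_le_iff]
  exact ⟨fun h ↦ ext fun n ↦ by simpa using h n (Nat.zero_le n), by rintro rfl; simp⟩

@[simp]
theorem degSucc_zero : degSucc (0 : SkewPoly σ) = 0 := degSucc_eq_zero.2 rfl

theorem degSucc_eq_iff {p : SkewPoly σ} {n : ℕ} :
    degSucc p = n + 1 ↔ coeff n p ≠ 0 ∧ ∀ m > n, coeff m p = 0 := by
  constructor
  · intro h
    refine ⟨fun h0 ↦ ?_, fun m hm ↦ coeff_eq_zero_of_degSucc_le (by omega)⟩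
    have : degSucc p ≤ n := degSucc_le_iff.2 fun m hm ↦ by
      rcases hm.eq_or_lt with rfl | hm
      · exact h0
      · exact coeff_eq_zero_of_degSucc_le (by omega)
    omega
  · rintro ⟨h0, h⟩
    refine le_antisymm (degSucc_le_iff.2 fun m hm ↦ h m hm) ?_
    by_contra hlt
    exact h0 (coeff_eq_zero_of_degSucc_le (by omega))

theorem exists_degSucc_eq {p : SkewPoly σ} (hp : p ≠ 0) : ∃ n, degSucc p = n + 1 :=
  Nat.exists_eq_succ_of_ne_zero (mt degSucc_eq_zero.1 hp)

theorem degSucc_le_one_iff {p : SkewPoly σ} : degSucc p ≤ 1 ↔ p ∈ Set.range (C σ) := by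
  rw [degSucc_le_iff]
  constructor
  · intro h
    refine ⟨coeff 0 p, ext fun n ↦ ?_⟩
    rw [coeff_C]
    split_ifs with hn
    · rw [hn]
    · exact (h n (by omega)).symm
  · rintro ⟨a, rfl⟩ m hm
    rw [coeff_C, if_neg (by omega)]

theorem coeff_mul_of_degSucc_le {p q : SkewPoly σ} {m n : ℕ} (hp : degSucc p ≤ m + 1)
    (hq : degSucc q ≤ n + 1) : coeff (m + n) (p * q) = coeff m p * (σ ^ m) (coeff n q) := by
  rw [coeff_mul, Finset.sum_eq_single (m, n)]
  · rintro ⟨x, y⟩ hxy hne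
    have h1 := Finset.HasAntidiagonal.mem_antidiagonal.1 hxy
    rcases lt_trichotomy x m with h | h | h
    · rw [coeff_eq_zero_of_degSucc_le (p := q) (by simp only at h1; omega), map_zero, mul_zero]
    · exact absurd (by simp only at h1; simp only [Prod.mk.injEq]; omega) hne
    · rw [coeff_eq_zero_of_degSucc_le (p := p) (by simp only; omega), zero_mul]
  · simp

theorem degSucc_mul_le {p q : SkewPoly σ} {m n : ℕ} (hp : degSucc p ≤ m + 1)
    (hq : degSucc q ≤ n + 1) : degSucc (p * q) ≤ m + n + 1 := by
  rw [degSucc_le_iff]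
  intro l hl
  rw [coeff_mul, Finset.sum_eq_zero]
  rintro ⟨x, y⟩ hxy
  have h1 := Finset.HasAntidiagonal.mem_antidiagonal.1 hxy
  simp only at h1
  rcases Nat.lt_or_ge m x with h | h
  · rw [coeff_eq_zero_of_degSucc_le (p := p) (by simp only; omega), zero_mul]
  · rw [coeff_eq_zero_of_degSucc_le (p := q) (by simp only; omega), map_zero, mul_zero]

/-- Subtracting a polynomial with the same leading term lowers the degree. -/
theorem degSucc_sub_le_of_coeff_eq {p q : SkewPoly σ} {n : ℕ} (hp : degSucc p ≤ n + 1)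
    (hq : degSucc q ≤ n + 1) (h : coeff n p = coeff n q) : degSucc (p - q) ≤ n :=
  degSucc_le_iff.2 fun m hm ↦ by
    rcases hm.eq_or_lt with rfl | hm
    · rw [map_sub, h, sub_self]
    · rw [map_sub, degSucc_le_iff.1 hp m hm, degSucc_le_iff.1 hq m hm, sub_zero]

theorem degSucc_C_mul_θ_pow_le (a : A) (n : ℕ) : degSucc (C σ a * θ σ ^ n) ≤ n + 1 :=
  degSucc_le_iff.2 fun m hm ↦ by rw [coeff_C_mul_θ_pow, if_neg (by omega)]

theorem degSucc_mul [IsDomain A] {p q : SkewPoly σ} {m n : ℕ} (hp : degSucc p = m + 1)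
    (hq : degSucc q = n + 1) : degSucc (p * q) = m + n + 1 := by
  rw [degSucc_eq_iff, coeff_mul_of_degSucc_le hp.le hq.le]
  have h1 := (degSucc_eq_iff.1 hp).1
  have h2 := (degSucc_eq_iff.1 hq).1
  exact ⟨mul_ne_zero h1 ((map_ne_zero_iff _ (σ ^ m).injective).2 h2), fun l hl ↦
    coeff_eq_zero_of_degSucc_le ((degSucc_mul_le hp.le hq.le).trans hl)⟩

instance [Nontrivial A] : Nontrivial (SkewPoly σ) := C_injective.nontrivial

instance [IsDomain A] : NoZeroDivisors (SkewPoly σ) where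
  eq_zero_or_eq_zero_of_mul_eq_zero {p q} h := by
    by_contra! hpq
    obtain ⟨m, hm⟩ := exists_degSucc_eq hpq.1
    obtain ⟨n, hn⟩ := exists_degSucc_eq hpq.2
    have := degSucc_mul hm hn
    simp [h] at this

instance [IsDomain A] : IsDomain (SkewPoly σ) := NoZeroDivisors.to_isDomain _

end Coeff

end SkewPoly

/-- A ring as a right module over itself is free of rank one. -/
def opSelfEquiv (A : Type u) [Ring A] : A ≃ₗ[Aᵐᵒᵖ] Aᵐᵒᵖ where
  toFun a := MulOpposite.op a
  invFun a := a.unop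
  map_add' _ _ := rfl
  map_smul' _ _ := rfl
  left_inv _ := rfl
  right_inv _ := rfl

namespace SkewPoly

variable {A : Type u} [CommRing A] {σ : A ≃+* A}

/-- The ideal of leading coefficients of the elements of degree at most `d` of a right ideal. -/
def leadIdeal (I : Submodule (SkewPoly σ)ᵐᵒᵖ (SkewPoly σ)) (d : ℕ) : Ideal A where
  carrier := {a | ∃ p ∈ I, degSucc p ≤ d + 1 ∧ coeff d p = a}
  zero_mem' := ⟨0, I.zero_mem, by simp, by simp⟩
  add_mem' := by
    rintro _ _ ⟨p, hp, hpd, rfl⟩ ⟨q, hq, hqd, rfl⟩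
    refine ⟨p + q, I.add_mem hp hq, degSucc_le_iff.2 fun m hm ↦ ?_, map_add _ _ _⟩
    rw [map_add, degSucc_le_iff.1 hpd m hm, degSucc_le_iff.1 hqd m hm, add_zero]
  smul_mem' := by
    rintro c _ ⟨p, hp, hpd, rfl⟩
    refine ⟨p * C σ ((σ ^ d).symm c), I.smul_mem (MulOpposite.op _) hp,
      degSucc_le_iff.2 fun m hm ↦ ?_, ?_⟩
    · rw [coeff_mul_C, degSucc_le_iff.1 hpd m hm, zero_mul]
    · rw [coeff_mul_C, RingEquiv.apply_symm_apply, smul_eq_mul, mul_comm]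

theorem leadIdeal_mono {I J : Submodule (SkewPoly σ)ᵐᵒᵖ (SkewPoly σ)} (h : I ≤ J) (d : ℕ) :
    leadIdeal I d ≤ leadIdeal J d := by
  rintro a ⟨p, hp, h'⟩
  exact ⟨p, h hp, h'⟩

theorem leadIdeal_le_succ (I : Submodule (SkewPoly σ)ᵐᵒᵖ (SkewPoly σ)) :
    Monotone (leadIdeal I) := by
  refine monotone_nat_of_le_succ fun d ↦ ?_
  rintro _ ⟨p, hp, hpd, rfl⟩
  refine ⟨p * θ σ, I.smul_mem (MulOpposite.op _) hp, degSucc_le_iff.2 fun m hm ↦ ?_,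
    coeff_mul_θ_succ p d⟩
  obtain ⟨m, rfl⟩ : ∃ l, m = l + 1 := ⟨m - 1, by omega⟩
  rw [coeff_mul_θ_succ, degSucc_le_iff.1 hpd m (by omega)]

theorem le_of_leadIdeal_le {I J : Submodule (SkewPoly σ)ᵐᵒᵖ (SkewPoly σ)} (hIJ : I ≤ J)
    (h : ∀ d, leadIdeal J d ≤ leadIdeal I d) : J ≤ I := by
  have key : ∀ n, ∀ p ∈ J, degSucc p ≤ n → p ∈ I := by
    intro n
    induction n with
    | zero =>
      intro p _ hp
      rw [degSucc_eq_zero.1 (Nat.le_zero.1 hp)]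
      exact I.zero_mem
    | succ n ih =>
      intro p hp hpn
      obtain ⟨q, hq, hqn, hqp⟩ := h n ⟨p, hp, hpn, rfl⟩
      have := ih (p - q) (J.sub_mem hp (hIJ hq)) (degSucc_sub_le_of_coeff_eq hpn hqn hqp.symm)
      simpa using I.add_mem this hq
  exact fun p hp ↦ key _ p hp le_rfl

/-- **Hilbert's basis theorem** for right ideals of skew polynomial rings. -/
instance [IsNoetherianRing A] : IsNoetherian (SkewPoly σ)ᵐᵒᵖ (SkewPoly σ) := by
  rw [← monotone_stabilizes_iff_noetherian]
  intro f
  obtain ⟨_, ⟨⟨n₀, d₀⟩, rfl⟩, hmax⟩ := set_has_maximal_iff_noetherian.2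
    (inferInstance : IsNoetherian A A) (Set.range fun x : ℕ × ℕ ↦ leadIdeal (f x.1) x.2)
    (Set.range_nonempty _)
  have hst : ∀ d, ∃ N, ∀ m ≥ N, leadIdeal (f N) d = leadIdeal (f m) d := fun d ↦
    monotone_stabilizes_iff_noetherian.2 (inferInstance : IsNoetherian A A)
      ⟨fun n ↦ leadIdeal (f n) d, fun _ _ h ↦ leadIdeal_mono (f.monotone h) d⟩
  choose N hN using hst
  set M := max n₀ ((Finset.range d₀).sup N)
  refine ⟨M, fun m hm ↦ le_antisymm (f.monotone hm)
    (le_of_leadIdeal_le (f.monotone hm) fun d ↦ ?_)⟩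
  by_cases hd : d < d₀
  · have h1 : N d ≤ M := le_trans (Finset.le_sup (f := N) (Finset.mem_range.2 hd))
      (le_max_right _ _)
    rw [← hN d M h1, ← hN d m (h1.trans hm)]
  · push Not at hd
    have hle : leadIdeal (f n₀) d₀ ≤ leadIdeal (f M) d :=
      (leadIdeal_mono (f.monotone (le_max_left _ _)) d₀).trans (leadIdeal_le_succ _ hd)
    have h2 : leadIdeal (f n₀) d₀ = leadIdeal (f m) d := by
      by_contra hne
      exact hmax _ ⟨(m, d), rfl⟩
        (lt_of_le_of_ne (hle.trans (leadIdeal_mono (f.monotone hm) d)) hne)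
    rw [← h2]
    exact hle

instance [IsNoetherianRing A] : IsNoetherianRing (SkewPoly σ)ᵐᵒᵖ :=
  isNoetherian_of_linearEquiv (opSelfEquiv (SkewPoly σ))

end SkewPoly

theorem mem_span_op_singleton {A : Type u} [Ring A] {a b : A} :
    b ∈ Submodule.span Aᵐᵒᵖ {a} ↔ ∃ c, b = a * c := by
  rw [Submodule.mem_span_singleton]
  exact ⟨fun ⟨c, hc⟩ ↦ ⟨c.unop, hc.symm⟩, fun ⟨c, hc⟩ ↦ ⟨MulOpposite.op c, hc.symm⟩⟩

theorem SkewPoly.degSucc_mul_C {A : Type u} [Ring A] [IsDomain A] {σ : A ≃+* A} (p : SkewPoly σ)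
    {a : A} (ha : a ≠ 0) : degSucc (p * C σ a) = degSucc p := by
  refine eq_of_forall_ge_iff fun n ↦ ?_
  simp only [degSucc_le_iff, coeff_mul_C]
  refine forall₂_congr fun m _ ↦ ⟨fun h ↦ ?_, fun h ↦ by rw [h, zero_mul]⟩
  exact (mul_eq_zero.1 h).resolve_right ((map_ne_zero_iff _ (σ ^ m).injective).2 ha)

section Reduction

open SkewPoly

variable {k : Type v} {R : Type u} [Field k] [CommRing R] [IsDomain R]
  [IsDiscreteValuationRing R] [Algebra k R]

/-- The residue map `R → R/XR = k`. -/
def residueToField (hk : Function.Bijective (algebraMap k (IsLocalRing.ResidueField R))) :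
    R →+* k :=
  ((RingEquiv.ofBijective _ hk).symm : IsLocalRing.ResidueField R →+* k).comp
    (IsLocalRing.residue R)

variable (hk : Function.Bijective (algebraMap k (IsLocalRing.ResidueField R)))

theorem residueToField_algebraMap (c : k) : residueToField hk (algebraMap k R c) = c :=
  (RingEquiv.ofBijective _ hk).symm_apply_apply c

theorem residueToField_eq_zero_iff {r : R} :
    residueToField hk r = 0 ↔ r ∈ IsLocalRing.maximalIdeal R := by
  simp [residueToField]

theorem isUnit_iff_residueToField_ne_zero {r : R} : IsUnit r ↔ residueToField hk r ≠ 0 := by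
  rw [Ne, residueToField_eq_zero_iff, IsLocalRing.mem_maximalIdeal, mem_nonunits_iff, not_not]

variable (α : R ≃ₐ[k] R)

theorem residueToField_apply (r : R) :
    residueToField hk ((α : R ≃+* R) r) = residueToField hk r := by
  set c := residueToField hk r with hc
  have h1 : ¬ IsUnit (r - algebraMap k R c) := by
    rw [isUnit_iff_residueToField_ne_zero hk, not_not, map_sub, residueToField_algebraMap, hc,
      sub_self]
  have h2 : ¬ IsUnit ((α : R ≃+* R) (r - algebraMap k R c)) := by
    exact mt (isUnit_map_iff (α : R ≃+* R) _).1 h1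
  rw [isUnit_iff_residueToField_ne_zero hk, not_not, map_sub, map_sub] at h2
  have h3 : (α : R ≃+* R) (algebraMap k R c) = algebraMap k R c := α.commutes c
  rw [h3, residueToField_algebraMap] at h2
  exact sub_eq_zero.1 h2

theorem residueToField_pow_apply (n : ℕ) (r : R) :
    residueToField hk (((α : R ≃+* R) ^ n) r) = residueToField hk r := by
  induction n with
  | zero => rfl
  | succ n ih =>
    rw [pow_succ']
    exact (residueToField_apply hk α _).trans ih

/-- Reduction modulo `X`, as a ring homomorphism `S → S/XS = k[θ]`. -/
def reduce : RingS α →+* Polynomial k :=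
  letI := skewAction (α : R ≃+* R)
  SkewMonoidAlgebra.liftNCRingHom (k := R) (G := Multiplicative ℕ)
    (Polynomial.C.comp (residueToField hk)) (powersHom _ Polynomial.X) (by
      intro a n
      have h : residueToField hk (((α : R ≃+* R) ^ n.toAdd) a) = residueToField hk a :=
        residueToField_pow_apply hk α _ _
      exact (mul_comm _ _).trans (congrArg (fun b ↦ Polynomial.X ^ n.toAdd * Polynomial.C b) h))

theorem reduce_C_mul_θ_pow (r : R) (n : ℕ) :
    reduce hk α (constS α r * θ _ ^ n) = Polynomial.C (residueToField hk r) * Polynomial.X ^ n := by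
  let _ := skewAction (α : R ≃+* R)
  rw [C_mul_θ_pow]
  exact SkewMonoidAlgebra.liftNC_single _ _ _ _

@[simp]
theorem reduce_constS (r : R) :
    reduce hk α (constS α r) = Polynomial.C (residueToField hk r) := by
  simpa using reduce_C_mul_θ_pow hk α r 0

@[simp]
theorem reduce_θ : reduce hk α (θ _) = Polynomial.X := by
  simpa using reduce_C_mul_θ_pow hk α 1 1

theorem coeff_reduce (p : RingS α) (n : ℕ) :
    (reduce hk α p).coeff n = residueToField hk (coeff n p) := by
  induction p using SkewPoly.induction_on with
  | h0 => simp
  | hadd p q hp hq => simp [hp, hq]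
  | hmon a m =>
    rw [reduce_C_mul_θ_pow, coeff_C_mul_θ_pow, Polynomial.coeff_C_mul_X_pow]
    simp only [eq_comm (a := n)]
    split_ifs <;> simp

@[simp]
theorem reduce_polyToS (f : Polynomial k) : reduce hk α (polyToS α f) = f := by
  rw [polyToS, Polynomial.hom_eval₂]
  conv_rhs => rw [← Polynomial.eval₂_C_X (p := f)]
  congr 1
  · ext c
    simp [residueToField_algebraMap]
  · exact reduce_θ hk α

variable {X : R} (hX : IsLocalRing.maximalIdeal R = Ideal.span {X})
include hX

theorem uniformizer_ne_zero : X ≠ 0 :=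
  ((IsDiscreteValuationRing.irreducible_iff_uniformizer X).2 hX).ne_zero

theorem residueToField_eq_zero_iff_dvd {r : R} : residueToField hk r = 0 ↔ X ∣ r := by
  rw [residueToField_eq_zero_iff, hX, Ideal.mem_span_singleton]

theorem reduce_X : reduce hk α (constS α X) = 0 := by
  rw [reduce_constS, (residueToField_eq_zero_iff_dvd hk hX).2 dvd_rfl, map_zero]

theorem constS_X_ne_zero : constS α X ≠ 0 :=
  (map_ne_zero_iff _ C_injective).2 (uniformizer_ne_zero hX)

theorem exists_unit_pow_apply_X (n : ℕ) : ∃ u : Rˣ, ((α : R ≃+* R) ^ n) X = X * u := by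
  have hX' : Irreducible X := (IsDiscreteValuationRing.irreducible_iff_uniformizer X).2 hX
  have hα : Irreducible (((α : R ≃+* R) ^ n) X) := (MulEquiv.irreducible_iff _).2 hX'
  obtain ⟨u, hu⟩ := IsDiscreteValuationRing.associated_of_irreducible R hX' hα
  exact ⟨u, hu.symm⟩

theorem exists_X_mul_eq (s : RingS α) : ∃ s' : RingS α, constS α X * s = s' * constS α X := by
  induction s using SkewPoly.induction_on with
  | h0 => exact ⟨0, by simp⟩
  | hadd p q hp hq =>
    obtain ⟨p', hp⟩ := hp
    obtain ⟨q', hq⟩ := hq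
    exact ⟨p' + q', by rw [mul_add, add_mul, hp, hq]⟩
  | hmon a n =>
    obtain ⟨u, hu⟩ := exists_unit_pow_apply_X α hX n
    refine ⟨constS α (a * ↑u⁻¹) * θ _ ^ n, ?_⟩
    rw [mul_assoc, θ_pow_mul_C, hu, ← mul_assoc, ← mul_assoc, ← map_mul, ← map_mul]
    congr 2
    calc X * a = a * (↑u⁻¹ * u) * X := by rw [Units.inv_mul]; ring
      _ = _ := by ring

theorem exists_pow_X_mul_eq (s : RingS α) (n : ℕ) :
    ∃ s' : RingS α, constS α X ^ n * s = s' * constS α X ^ n := by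
  induction n generalizing s with
  | zero => exact ⟨s, by simp⟩
  | succ n ih =>
    obtain ⟨s', h'⟩ := exists_X_mul_eq α hX s
    obtain ⟨s'', h''⟩ := ih s'
    exact ⟨s'', by rw [pow_succ, mul_assoc, h', ← mul_assoc, h'', mul_assoc]⟩

theorem exists_mul_pow_X_eq (s : RingS α) (n : ℕ) :
    ∃ s' : RingS α, s * constS α X ^ n = constS α X ^ n * s' := by
  induction n generalizing s with
  | zero => exact ⟨s, by simp⟩
  | succ n ih =>
    obtain ⟨s', h'⟩ := ih s
    obtain ⟨s'', h''⟩ := exists_mul_X_eq α hX s'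
    exact ⟨s'', by rw [pow_succ, ← mul_assoc, h', mul_assoc, h'', mul_assoc]⟩

theorem reduce_eq_zero_iff {p : RingS α} : reduce hk α p = 0 ↔ ∃ q, p = constS α X * q := by
  constructor
  · intro h
    have hc : ∀ n, ∃ c, coeff n p = X * c := fun n ↦ by
      rw [← dvd_def, ← residueToField_eq_zero_iff_dvd hk hX, ← coeff_reduce, h,
        Polynomial.coeff_zero]
    have key : ∀ n, ∀ p : RingS α, degSucc p ≤ n → (∀ n, ∃ c, coeff n p = X * c) →
        ∃ q, p = constS α X * q := by
      intro n
      induction n with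
      | zero => exact fun p hp _ ↦ ⟨0, by rw [degSucc_eq_zero.1 (Nat.le_zero.1 hp), mul_zero]⟩
      | succ n ih =>
        intro p hp hc
        obtain ⟨c, hcn⟩ := hc n
        obtain ⟨q, hq⟩ := ih (p - constS α (X * c) * θ _ ^ n)
          (degSucc_sub_le_of_coeff_eq hp (degSucc_C_mul_θ_pow_le _ _)
            (by rw [coeff_C_mul_θ_pow, if_pos rfl, hcn])) (fun m ↦ by
            obtain ⟨d, hd⟩ := hc m
            rw [map_sub, coeff_C_mul_θ_pow, hd]
            split_ifs
            · exact ⟨d - c, by ring⟩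
            · exact ⟨d, by ring⟩)
        exact ⟨q + constS α c * θ _ ^ n, by
          rw [mul_add, ← hq, ← mul_assoc, ← map_mul]; abel⟩
    exact key _ p le_rfl hc
  · rintro ⟨q, rfl⟩
    rw [map_mul, reduce_X hk α hX, zero_mul]

theorem reduce_eq_zero_iff' {p : RingS α} : reduce hk α p = 0 ↔ ∃ q, p = q * constS α X := by
  rw [reduce_eq_zero_iff hk α hX]
  constructor
  · rintro ⟨q, rfl⟩
    exact exists_X_mul_eq α hX q
  · rintro ⟨q, rfl⟩
    exact exists_mul_X_eq α hX q

theorem exists_eq_mul_pow_X {p : RingS α} (hp : p ≠ 0) :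
    ∃ (q : RingS α) (n : ℕ), p = q * constS α X ^ n ∧ reduce hk α q ≠ 0 := by
  obtain ⟨d, hd⟩ := exists_degSucc_eq hp
  have hd := (degSucc_eq_iff.1 hd).1
  have hX' : Irreducible X := (IsDiscreteValuationRing.irreducible_iff_uniformizer X).2 hX
  obtain ⟨n, hn⟩ := FiniteMultiplicity.of_not_isUnit hX'.not_isUnit hd
  have key : ∀ n, ∀ p : RingS α, ¬ X ^ n ∣ coeff d p →
      ∃ (q : RingS α) (n : ℕ), p = q * constS α X ^ n ∧ reduce hk α q ≠ 0 := by
    intro n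
    induction n with
    | zero => exact fun p h ↦ absurd (by simp) h
    | succ n ih =>
      intro p h
      by_cases hp : reduce hk α p = 0
      · obtain ⟨q, rfl⟩ := (reduce_eq_zero_iff' hk α hX).1 hp
        obtain ⟨u, hu⟩ := exists_unit_pow_apply_X α hX d
        obtain ⟨r, m, rfl, hr⟩ := ih q fun hq ↦ h (by
          rw [coeff_mul_C, hu, pow_succ]
          exact mul_dvd_mul hq (dvd_mul_right _ _))
        exact ⟨r, m + 1, by rw [pow_succ, mul_assoc], hr⟩
      · exact ⟨p, 0, by simp, hp⟩
  exact key _ p hn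

/-- Division with remainder in `S`, up to powers of `X`. -/
theorem exists_mul_pow_X_eq_mul_add {z : RingS α} (hz : z ≠ 0) (s : RingS α) :
    ∃ (n : ℕ) (q r : RingS α), s * constS α X ^ n = z * q + r ∧ degSucc r < degSucc z := by
  obtain ⟨d, hd⟩ := exists_degSucc_eq hz
  have hX' : Irreducible X := (IsDiscreteValuationRing.irreducible_iff_uniformizer X).2 hX
  have key : ∀ m, ∀ s : RingS α, degSucc s ≤ m →
      ∃ (n : ℕ) (q r : RingS α), s * constS α X ^ n = z * q + r ∧ degSucc r < degSucc z := by
    intro m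
    induction m with
    | zero => exact fun s hs ↦ ⟨0, 0, s, by simp, by omega⟩
    | succ m ih =>
      intro s hs
      by_cases hmd : m < d
      · exact ⟨0, 0, s, by simp, by omega⟩
      push Not at hmd
      obtain ⟨e, rfl⟩ := Nat.exists_eq_add_of_le hmd
      obtain ⟨v, u, hv⟩ :=
        IsDiscreteValuationRing.eq_unit_mul_pow_irreducible (degSucc_eq_iff.1 hd).1 hX'
      obtain ⟨u', hu'⟩ := exists_unit_pow_apply_X α hX (d + e)
      set c : R := coeff (d + e) s * u' ^ v * ↑u⁻¹ with hc
      set c' : R := ((α : R ≃+* R) ^ d).symm c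
      set s' : RingS α := s * constS α X ^ v - z * (constS α c' * θ _ ^ e) with hs'
      have hle1 : degSucc (s * constS α X ^ v) ≤ d + e + 1 := by
        rw [← map_pow, degSucc_mul_C _ (pow_ne_zero _ (uniformizer_ne_zero hX))]
        exact hs
      have hle2 : degSucc (z * (constS α c' * θ _ ^ e)) ≤ d + e + 1 :=
        degSucc_mul_le hd.le (degSucc_C_mul_θ_pow_le _ _)
      obtain ⟨n, q, r, h, hr⟩ := ih s' (degSucc_sub_le_of_coeff_eq hle1 hle2 (by
        rw [coeff_mul_of_degSucc_le hd.le (degSucc_C_mul_θ_pow_le _ _), coeff_C_mul_θ_pow,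
          if_pos rfl, ← map_pow, coeff_mul_C, map_pow, hu', hv, RingEquiv.apply_symm_apply, hc]
        calc _ = (u * ↑u⁻¹ : R) * (coeff (d + e) s * (X * u') ^ v) := by rw [Units.mul_inv]; ring
          _ = _ := by ring))
      obtain ⟨t, ht⟩ : ∃ t, constS α c' * θ _ ^ e * constS α X ^ n = t := ⟨_, rfl⟩
      refine ⟨v + n, q + t, r, ?_, hr⟩
      rw [mul_add, ← ht, ← mul_assoc z, add_right_comm, ← h, hs', sub_mul, pow_add, ← mul_assoc]
      abel
  exact key _ s le_rfl

/-- If `z` is not divisible by `X` then `S/zS` has no `X`-torsion. -/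
theorem mem_span_of_mul_X_mem {z s : RingS α} (hz : reduce hk α z ≠ 0)
    (h : s * constS α X ∈ Submodule.span (RingS α)ᵐᵒᵖ {z}) :
    s ∈ Submodule.span (RingS α)ᵐᵒᵖ {z} := by
  obtain ⟨c, hc⟩ := mem_span_op_singleton.1 h
  have h1 : reduce hk α z * reduce hk α c = 0 := by
    rw [← map_mul, ← hc, map_mul, reduce_X hk α hX, mul_zero]
  obtain ⟨q, rfl⟩ := (reduce_eq_zero_iff' hk α hX).1 ((mul_eq_zero.1 h1).resolve_left hz)
  rw [← mul_assoc] at hc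
  exact mem_span_op_singleton.2 ⟨q, mul_right_cancel₀ (constS_X_ne_zero α hX) hc⟩

omit hX [IsDomain R] [IsDiscreteValuationRing R] in
theorem mem_of_mul_pow_X_mem {I : Submodule (RingS α)ᵐᵒᵖ (RingS α)}
    (hI : ∀ s, s * constS α X ∈ I → s ∈ I) {s : RingS α} (n : ℕ)
    (h : s * constS α X ^ n ∈ I) : s ∈ I := by
  induction n with
  | zero => simpa using h
  | succ n ih => exact ih (hI _ (by rwa [mul_assoc, ← pow_succ]))

/-- The right ideals `I` of `S` such that `S/I` has no `X`-torsion are principal. -/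
theorem exists_eq_span_singleton {I : Submodule (RingS α)ᵐᵒᵖ (RingS α)} (h0 : I ≠ ⊥)
    (hI : ∀ s, s * constS α X ∈ I → s ∈ I) :
    ∃ w, reduce hk α w ≠ 0 ∧ I = Submodule.span (RingS α)ᵐᵒᵖ {w} := by
  obtain ⟨p, hp, hp0⟩ := Submodule.exists_mem_ne_zero_of_ne_bot h0
  obtain ⟨w, ⟨hwI, hw0⟩, hmin⟩ := (measure (degSucc (σ := (α : R ≃+* R)))).wf.has_min
    {w | w ∈ I ∧ w ≠ 0} ⟨p, hp, hp0⟩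
  obtain ⟨w', n, rfl, hw'⟩ := exists_eq_mul_pow_X hk α hX hw0
  refine ⟨w', hw', le_antisymm (fun s hs ↦ ?_) ?_⟩
  · have hw0' : w' ≠ 0 := by rintro rfl; simp at hw'
    obtain ⟨m, q, r, h, hr⟩ := exists_mul_pow_X_eq_mul_add α hX hw0' s
    have hrI : r ∈ I := by
      rw [← sub_eq_iff_eq_add'.2 h]
      exact I.sub_mem (I.smul_mem (MulOpposite.op _) hs)
        (I.smul_mem (MulOpposite.op _) (mem_of_mul_pow_X_mem α hI n hwI))
    have hr0 : r = 0 := by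
      by_contra hr0
      refine hmin r ⟨hrI, hr0⟩ ?_
      change degSucc r < degSucc (w' * constS α X ^ n)
      rw [← map_pow, degSucc_mul_C _ (pow_ne_zero _ (uniformizer_ne_zero hX))]
      exact hr
    exact mem_of_mul_pow_X_mem α (fun _ ↦ mem_span_of_mul_X_mem hk α hX hw') m
      (mem_span_op_singleton.2 ⟨q, by rw [h, hr0, add_zero]⟩)
  · rw [Submodule.span_singleton_le_iff_mem]
    exact mem_of_mul_pow_X_mem α hI n hwI

include hk in
/-- For `z` irreducible and not divisible by `X`, `S/zS` has no proper `X`-torsion-free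
quotient. -/
theorem eq_span_or_eq_top_of_irreducible {z : RingS α} (hz : Irreducible z)
    {J : Submodule (RingS α)ᵐᵒᵖ (RingS α)} (hJ : ∀ s, s * constS α X ∈ J → s ∈ J)
    (hzJ : z ∈ J) : J = Submodule.span (RingS α)ᵐᵒᵖ {z} ∨ J = ⊤ := by
  have h0 : J ≠ ⊥ := by
    rintro rfl
    exact hz.ne_zero (by simpa using hzJ)
  obtain ⟨d, -, rfl⟩ := exists_eq_span_singleton hk α hX h0 hJ
  obtain ⟨c, rfl⟩ := mem_span_op_singleton.1 hzJ
  rcases hz.isUnit_or_isUnit rfl with ⟨u, rfl⟩ | ⟨u, rfl⟩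
  · right
    rw [eq_top_iff]
    exact fun s _ ↦ mem_span_op_singleton.2 ⟨↑u⁻¹ * s, by simp⟩
  · left
    refine le_antisymm ?_ ?_ <;>
      rw [Submodule.span_singleton_le_iff_mem, mem_span_op_singleton]
    · exact ⟨↑u⁻¹, by simp⟩
    · exact ⟨u, rfl⟩

omit hX [IsDiscreteValuationRing R] in
theorem span_ne_top_of_not_isUnit {z : RingS α} (hz : ¬ IsUnit z) :
    Submodule.span (RingS α)ᵐᵒᵖ {z} ≠ ⊤ := by
  intro h
  obtain ⟨c, hc⟩ := mem_span_op_singleton.1 (h ▸ Submodule.mem_top : (1 : RingS α) ∈ _)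
  exact hz (IsUnit.of_mul_eq_one c hc.symm)

theorem eq_top_of_one_mem_add_X {J : Submodule (RingS α)ᵐᵒᵖ (RingS α)} {z s : RingS α} {n : ℕ}
    (hz : z ∈ J) (hzs : z = 1 + s * constS α X) (hn : constS α X ^ n ∈ J) : J = ⊤ := by
  have key : ∀ m, ∀ t : RingS α, ∃ j ∈ J, ∃ t', t = j + t' * constS α X ^ m := by
    intro m
    induction m with
    | zero => exact fun t ↦ ⟨0, J.zero_mem, t, by simp⟩
    | succ m ih =>
      intro t
      obtain ⟨t₁, ht₁⟩ := exists_X_mul_eq α hX t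
      obtain ⟨j, hj, t', h⟩ := ih (-(s * t₁))
      refine ⟨z * t + j * constS α X, J.add_mem (J.smul_mem (MulOpposite.op _) hz)
        (J.smul_mem (MulOpposite.op _) hj), t', ?_⟩
      have h2 : t = z * t + -(s * t₁) * constS α X := by
        rw [hzs, add_mul, one_mul, mul_assoc s, ht₁, neg_mul, mul_assoc, add_neg_cancel_right]
      rw [pow_succ, ← mul_assoc, add_assoc, ← add_mul, ← h]
      exact h2
  rw [eq_top_iff]
  intro t _
  obtain ⟨j, hj, t', rfl⟩ := key n t
  obtain ⟨t'', ht⟩ := exists_mul_pow_X_eq α hX t' n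
  rw [ht]
  exact J.add_mem hj (J.smul_mem (MulOpposite.op _) hn)

/-- If `z ≡ 1` modulo `X` is irreducible then `S/zS` is simple. -/
theorem isCoatom_span_of_irreducible {z : RingS α} (hz : Irreducible z)
    (hz1 : reduce hk α z = 1) : IsCoatom (Submodule.span (RingS α)ᵐᵒᵖ {z}) := by
  refine ⟨span_ne_top_of_not_isUnit α hz.not_isUnit, fun J hJ ↦ ?_⟩
  have hzJ : z ∈ J := hJ.le (Submodule.mem_span_singleton_self z)
  let J' : Submodule (RingS α)ᵐᵒᵖ (RingS α) :=
    { carrier := {s | ∃ n, s * constS α X ^ n ∈ J}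
      zero_mem' := ⟨0, by simp⟩
      add_mem' := by
        rintro a b ⟨m, hm⟩ ⟨n, hn⟩
        refine ⟨m + n, ?_⟩
        rw [add_mul]
        refine J.add_mem ?_ ?_
        · rw [pow_add, ← mul_assoc]
          exact J.smul_mem (MulOpposite.op _) hm
        · rw [add_comm, pow_add, ← mul_assoc]
          exact J.smul_mem (MulOpposite.op _) hn
      smul_mem' := by
        rintro c a ⟨n, hn⟩
        obtain ⟨c', hc'⟩ := exists_mul_pow_X_eq α hX c.unop n
        refine ⟨n, ?_⟩
        change a * c.unop * _ ∈ J
        rw [mul_assoc, hc', ← mul_assoc]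
        exact J.smul_mem (MulOpposite.op _) hn }
  have hJ' : J ≤ J' := fun s hs ↦ ⟨0, by simpa using hs⟩
  rcases eq_span_or_eq_top_of_irreducible hk α hX hz (J := J')
    (fun s ⟨n, hn⟩ ↦ ⟨n + 1, by rwa [pow_succ', ← mul_assoc]⟩) (hJ' hzJ) with h | h
  · exact absurd (hJ'.trans h.le) hJ.not_ge
  · obtain ⟨n, hn⟩ : (1 : RingS α) ∈ J' := h ▸ Submodule.mem_top
    obtain ⟨s, hs⟩ := (reduce_eq_zero_iff' hk α hX (p := z - 1)).1 (by
      rw [map_sub, hz1, map_one, sub_self])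
    exact eq_top_of_one_mem_add_X α hX hzJ (sub_eq_iff_eq_add'.1 hs) (by simpa using hn)

theorem IsTypeB.reduce_eq_one {w : RingS α} (hw : IsTypeB α X w) : reduce hk α w = 1 := by
  obtain ⟨-, s, -, rfl⟩ := hw
  rw [map_add, map_one, map_mul, reduce_X hk α hX, zero_mul, add_zero]

omit hX in
theorem isUnit_constS_of_reduce_ne_zero {r : R} (hr : reduce hk α (constS α r) ≠ 0) :
    IsUnit (constS α r) := by
  refine IsUnit.map _ ((isUnit_iff_residueToField_ne_zero hk).2 fun h ↦ hr ?_)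
  rw [reduce_constS, h, map_zero]

theorem IsTypeB.of_irreducible {w : RingS α} (hw : Irreducible w) (hw1 : reduce hk α w = 1) :
    IsTypeB α X w := by
  obtain ⟨s, hs⟩ := (reduce_eq_zero_iff hk α hX (p := w - 1)).1 (by
    rw [map_sub, hw1, map_one, sub_self])
  refine ⟨hw, s, ?_, sub_eq_iff_eq_add'.1 hs⟩
  rintro ⟨r, rfl⟩
  rw [← map_mul, sub_eq_iff_eq_add', ← map_one (SkewPoly.C _), ← map_add] at hs
  subst hs
  exact hw.not_isUnit (isUnit_constS_of_reduce_ne_zero hk α (by rw [hw1]; exact one_ne_zero))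

theorem IsTypeC.reduce {z : RingS α} (hz : IsTypeC α X z) :
    (reduce hk α z).Monic ∧ 0 < (reduce hk α z).natDegree := by
  obtain ⟨-, -, f, s, hf, hfk, rfl⟩ := hz
  rw [map_add, map_mul, reduce_X hk α hX, zero_mul, add_zero, reduce_polyToS]
  refine ⟨hf, Nat.pos_of_ne_zero fun h ↦ hfk ?_⟩
  exact ⟨_, (Polynomial.eq_C_of_natDegree_eq_zero h).symm⟩

theorem IsTypeC.of_irreducible {z : RingS α} (hz : Irreducible z) (hzθ : z ≠ θ _)
    (hm : (_root_.reduce hk α z).Monic) (hd : 0 < (_root_.reduce hk α z).natDegree) :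
    IsTypeC α X z := by
  obtain ⟨s, hs⟩ := (reduce_eq_zero_iff hk α hX
    (p := z - polyToS α (_root_.reduce hk α z))).1 (by
    rw [map_sub, reduce_polyToS, sub_self])
  refine ⟨hz, hzθ, _, s, hm, ?_, sub_eq_iff_eq_add'.1 hs⟩
  rintro ⟨c, hc⟩
  rw [← hc, Polynomial.natDegree_C] at hd
  exact hd.ne rfl

end Reduction

section ExtCyclic

/-- If `f : P → P` is an injective endomorphism of a projective module then
`Ext¹(P / f(P), M) = 0` if and only if every `g : P → M` factors through `f`. -/
theorem extOneVanishes_quotient_range_iff {B : Type u} [Ring B] {P M : Type u} [AddCommGroup P]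
    [Module B P] [AddCommGroup M] [Module B M] [Module.Projective B P] (f : P →ₗ[B] P)
    (hf : Function.Injective f) (N : Submodule B P) (hN : LinearMap.range f = N) :
    ExtOneVanishes (ModuleCat.of B (P ⧸ N)) (ModuleCat.of B M) ↔
      ∀ g : P →ₗ[B] M, ∃ h : P →ₗ[B] M, h ∘ₗ f = g := by
  let S : ShortComplex (ModuleCat.{u} B) :=
    ShortComplex.mk (ModuleCat.ofHom f) (ModuleCat.ofHom N.mkQ) (by
      ext x
      simpa using hN ▸ LinearMap.mem_range_self f x)
  have hS : S.ShortExact :=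
    { exact := by
        rw [ShortComplex.moduleCat_exact_iff]
        intro x hx
        have : x ∈ LinearMap.range f := hN ▸ (Submodule.Quotient.mk_eq_zero N).1 hx
        exact this
      mono_f := (ModuleCat.mono_iff_injective _).2 hf
      epi_g := (ModuleCat.epi_iff_surjective _).2 N.mkQ_surjective }
  have hP : Projective (ModuleCat.of B P) :=
    (IsProjective.iff_projective P).1 inferInstance
  have hP2 : Projective S.X₂ := hP
  constructor
  · intro hsub g
    have : Subsingleton (Abelian.Ext S.X₃ (ModuleCat.of B M) 1) := hsub
    obtain ⟨x, hx⟩ := Abelian.Ext.contravariant_sequence_exact₁ hS _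
      (Abelian.Ext.mk₀ (ModuleCat.ofHom g : S.X₁ ⟶ ModuleCat.of B M)) rfl (Subsingleton.elim _ _)
    obtain ⟨h, rfl⟩ := (Abelian.Ext.mk₀_bijective _ _).2 x
    rw [Abelian.Ext.mk₀_comp_mk₀] at hx
    have := (Abelian.Ext.mk₀_bijective _ _).1 hx
    exact ⟨h.hom, congrArg ModuleCat.Hom.hom this⟩
  · intro H
    refine subsingleton_of_forall_eq 0 fun x ↦ ?_
    obtain ⟨y, hy⟩ := Abelian.Ext.contravariant_sequence_exact₃ hS _ x
      (Abelian.Ext.eq_zero_of_projective (P := S.X₂) (n := 0) _) (n₀ := 0) rfl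
    obtain ⟨g, rfl⟩ := (Abelian.Ext.mk₀_bijective _ _).2 y
    obtain ⟨h, hh⟩ := H g.hom
    have hg : g = S.f ≫ ModuleCat.ofHom h := by
      ext1
      exact hh.symm
    rw [← hy, hg, ← Abelian.Ext.mk₀_comp_mk₀]
    exact hS.extClass_comp_assoc _

variable {A : Type u} [Ring A]

instance : Module.Projective Aᵐᵒᵖ A :=
  Module.Projective.of_equiv (opSelfEquiv A).symm

theorem extOneVanishes_rightCyclic_iff {a b : A} (ha : IsLeftRegular a) :
    ExtOneVanishes (rightCyclic a) (rightCyclic b) ↔ ∀ s : A, ∃ c d, s = b * c + d * a := by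
  have key := extOneVanishes_quotient_range_iff (B := Aᵐᵒᵖ) (P := A)
    (M := A ⧸ Submodule.span Aᵐᵒᵖ {b}) (LinearMap.mulLeft Aᵐᵒᵖ a) ha
    (Submodule.span Aᵐᵒᵖ {a}) (by
      ext x
      rw [mem_span_op_singleton]
      exact exists_congr fun c ↦ eq_comm)
  refine key.trans ⟨fun H s ↦ ?_, fun H g ↦ ?_⟩
  · obtain ⟨h, hh⟩ := H (Submodule.mkQ _ ∘ₗ LinearMap.mulLeft Aᵐᵒᵖ s)
    obtain ⟨d, hd⟩ := Submodule.mkQ_surjective _ (h 1)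
    have h1 : h a = Submodule.mkQ _ s := by
      simpa using LinearMap.congr_fun hh 1
    have h2 : h a = Submodule.mkQ _ (d * a) := by
      have h3 : h (MulOpposite.op a • (1 : A)) = MulOpposite.op a • h 1 := map_smul _ _ _
      rw [← hd, ← map_smul] at h3
      simpa using h3
    rw [h1] at h2
    obtain ⟨c, hc⟩ := mem_span_op_singleton.1 ((Submodule.Quotient.eq _).1 h2)
    exact ⟨c, d, sub_eq_iff_eq_add.1 hc⟩
  · obtain ⟨s, hs⟩ := Submodule.mkQ_surjective _ (g 1)
    obtain ⟨c, d, hcd⟩ := H s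
    refine ⟨Submodule.mkQ _ ∘ₗ LinearMap.mulLeft Aᵐᵒᵖ d, LinearMap.ext fun x ↦ ?_⟩
    have h1 : g x = Submodule.mkQ _ (s * x) := by
      have h3 : g (MulOpposite.op x • (1 : A)) = MulOpposite.op x • g 1 := map_smul _ _ _
      rw [← hs, ← map_smul] at h3
      simpa using h3
    rw [h1]
    refine (Submodule.Quotient.eq _).2 (mem_span_op_singleton.2 ⟨-(c * x), ?_⟩)
    change d * (a * x) - s * x = _
    rw [hcd]
    noncomm_ring

theorem extOneVanishes_leftCyclic_iff {a b : A} (hb : IsRightRegular b) :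
    ExtOneVanishes (leftCyclic b) (leftCyclic a) ↔ ∀ s : A, ∃ c d, s = b * c + d * a := by
  have key := extOneVanishes_quotient_range_iff (B := A) (P := A)
    (M := A ⧸ Submodule.span A {a}) (LinearMap.toSpanSingleton A A b) hb
    (Submodule.span A {b}) (LinearMap.range_toSpanSingleton _)
  refine key.trans ⟨fun H s ↦ ?_, fun H g ↦ ?_⟩
  · obtain ⟨h, hh⟩ := H (Submodule.mkQ _ ∘ₗ LinearMap.toSpanSingleton A A s)
    obtain ⟨c, hc⟩ := Submodule.mkQ_surjective _ (h 1)
    have h1 : h b = Submodule.mkQ _ s := by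
      simpa using LinearMap.congr_fun hh 1
    have h2 : h b = Submodule.mkQ _ (b * c) := by
      have h3 : h (b • (1 : A)) = b • h 1 := map_smul _ _ _
      rw [← hc, ← map_smul] at h3
      simpa using h3
    rw [h1] at h2
    obtain ⟨d, hd⟩ := Submodule.mem_span_singleton.1 ((Submodule.Quotient.eq _).1 h2)
    exact ⟨c, d, (sub_eq_iff_eq_add'.1 hd.symm)⟩
  · obtain ⟨s, hs⟩ := Submodule.mkQ_surjective _ (g 1)
    obtain ⟨c, d, hcd⟩ := H s
    refine ⟨Submodule.mkQ _ ∘ₗ LinearMap.toSpanSingleton A A c, LinearMap.ext fun x ↦ ?_⟩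
    have h1 : g x = Submodule.mkQ _ (x * s) := by
      have h3 : g (x • (1 : A)) = x • g 1 := map_smul _ _ _
      rw [← hs, ← map_smul] at h3
      simpa using h3
    rw [h1]
    refine (Submodule.Quotient.eq _).2 (Submodule.mem_span_singleton.2 ⟨-(x * d), ?_⟩)
    change -(x * d) * a = x * b * c - x * s
    rw [hcd]
    noncomm_ring

end ExtCyclic

section Comparison

open SkewPoly

variable {k : Type v} {R : Type u} [Field k] [CommRing R] [IsDomain R]
  [IsDiscreteValuationRing R] [Algebra k R]
  (hk : Function.Bijective (algebraMap k (IsLocalRing.ResidueField R)))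
  (α : R ≃ₐ[k] R) {X : R} (hX : IsLocalRing.maximalIdeal R = Ideal.span {X})

include hk hX

theorem exists_eq_add_mul_X {w : RingS α} (hw : reduce hk α w = 1) (n : ℕ) (s : RingS α) :
    ∃ c d, s = w * c + d * constS α X ^ n := by
  induction n with
  | zero => exact ⟨0, s, by simp⟩
  | succ n ih =>
    obtain ⟨c, d, h⟩ := ih
    obtain ⟨q, hq⟩ := (reduce_eq_zero_iff' hk α hX (p := d - w * d)).1 (by
      rw [map_sub, map_mul, hw, one_mul, sub_self])
    refine ⟨c + d * constS α X ^ n, q, ?_⟩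
    rw [pow_succ', ← mul_assoc q, ← hq, h]
    noncomm_ring

/-- If `w ≡ 1` modulo `X` then `T = S + wT`. -/
theorem exists_eq_toT_add {w : RingS α} (hw : reduce hk α w = 1) (t : RingT α) :
    ∃ (s : RingS α) (t' : RingT α), t = toT α s + toT α w * t' := by
  obtain ⟨n, s, hs⟩ := exists_mul_X_pow_eq_toT α hX t
  have hu := (isUnit_toT_X α (uniformizer_ne_zero hX)).pow n
  obtain ⟨c, d, rfl⟩ := exists_eq_add_mul_X hk α hX hw n s
  obtain ⟨v, hv⟩ := hu
  refine ⟨d, toT α c * ↑v⁻¹, ?_⟩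
  have : t = toT α (w * c + d * constS α X ^ n) * ↑v⁻¹ := by
    rw [← hs, ← hv, Units.mul_inv_cancel_right]
  rw [this, map_add, map_mul, map_mul, map_pow, ← hv, add_mul, Units.mul_inv_cancel_right,
    mul_assoc, add_comm]

/-- If `w` is not divisible by `X` then `wT ∩ S = wS`. -/
theorem exists_eq_mul_of_toT_eq_mul {w s : RingS α} (hw : reduce hk α w ≠ 0) {t : RingT α}
    (h : toT α s = toT α w * t) : ∃ c, s = w * c := by
  obtain ⟨n, c, hc⟩ := exists_mul_X_pow_eq_toT α hX t
  refine mem_span_op_singleton.1 (mem_of_mul_pow_X_mem α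
    (fun _ ↦ mem_span_of_mul_X_mem hk α hX hw) n (mem_span_op_singleton.2 ⟨c, ?_⟩))
  apply toT_injective α
  rw [map_mul, map_mul, map_pow, h, mul_assoc, hc]

theorem forall_exists_eq_add_toT_iff {w z : RingS α} (hw : reduce hk α w = 1) :
    (∀ t : RingT α, ∃ c d, t = toT α w * c + d * toT α z) ↔
      ∀ s : RingS α, ∃ c d, s = w * c + d * z := by
  constructor
  · intro H s
    obtain ⟨t₁, t₂, h⟩ := H (toT α s)
    obtain ⟨d, t, rfl⟩ := exists_eq_toT_add hk α hX hw t₂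
    obtain ⟨c, hc⟩ := exists_eq_mul_of_toT_eq_mul hk α hX (s := s - d * z)
      (by rw [hw]; exact one_ne_zero) (t := t₁ + t * toT α z) (by
        rw [map_sub, map_mul, h]
        noncomm_ring)
    exact ⟨c, d, sub_eq_iff_eq_add.1 hc⟩
  · intro H t
    obtain ⟨s, t', rfl⟩ := exists_eq_toT_add hk α hX hw t
    obtain ⟨c, d, rfl⟩ := H s
    refine ⟨toT α c + t', toT α d, ?_⟩
    rw [map_add, map_mul, map_mul]
    noncomm_ring

theorem extOneVanishes_iff_forall_exists_eq_add {w z : RingS α} (hw : reduce hk α w = 1)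
    (hz0 : z ≠ 0) :
    (ExtOneVanishes (rightCyclic z) (rightCyclic w) ↔ ∀ s, ∃ c d, s = w * c + d * z) ∧
    (ExtOneVanishes (leftCyclic w) (leftCyclic z) ↔ ∀ s, ∃ c d, s = w * c + d * z) ∧
    (ExtOneVanishes (rightCyclic (toT α z)) (rightCyclic (toT α w)) ↔
      ∀ s, ∃ c d, s = w * c + d * z) ∧
    (ExtOneVanishes (leftCyclic (toT α w)) (leftCyclic (toT α z)) ↔
      ∀ s, ∃ c d, s = w * c + d * z) := by
  have hw0 : w ≠ 0 := by rintro rfl; simp at hw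
  have hz1 := (map_ne_zero_iff _ (toT_injective α)).2 hz0
  have hw1 := (map_ne_zero_iff _ (toT_injective α)).2 hw0
  exact ⟨extOneVanishes_rightCyclic_iff (IsLeftCancelMulZero.mul_left_cancel_of_ne_zero hz0),
    extOneVanishes_leftCyclic_iff (IsRightCancelMulZero.mul_right_cancel_of_ne_zero hw0),
    (extOneVanishes_rightCyclic_iff (IsLeftCancelMulZero.mul_left_cancel_of_ne_zero hz1)).trans
      (forall_exists_eq_add_toT_iff hk α hX hw),
    (extOneVanishes_leftCyclic_iff (IsRightCancelMulZero.mul_right_cancel_of_ne_zero hw1)).trans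
      (forall_exists_eq_add_toT_iff hk α hX hw)⟩

end Comparison

section InjectiveHull

variable {A : Type u} [Ring A]

theorem Module.Injective.of_retract {J E : Type u} [AddCommGroup J] [Module A J] [AddCommGroup E]
    [Module A E] (hJ : Module.Injective A J) (i : E →ₗ[A] J) (r : J →ₗ[A] E)
    (h : ∀ x, r (i x) = x) : Module.Injective A E where
  out Y Z _ _ _ _ f hf g := by
    obtain ⟨g', hg'⟩ := hJ.out f hf (i ∘ₗ g)
    exact ⟨r ∘ₗ g', fun x ↦ by simp [hg', h]⟩

theorem exists_injective_embedding (V : Type u) [AddCommGroup V] [Module A V] :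
    ∃ (J : Type u) (_ : AddCommGroup J) (_ : Module A J) (j : V →ₗ[A] J),
      Module.Injective A J ∧ Function.Injective j := by
  have := ModuleCat.enoughInjectives.{u, u} (R := A)
  obtain ⟨⟨J, i, f, hf⟩⟩ := this.presentation (ModuleCat.of A V)
  refine ⟨J, inferInstance, inferInstance, f.hom, ?_, (ModuleCat.mono_iff_injective _).1 hf⟩
  exact Module.injective_module_of_injective_object A J

theorem exists_isInjectiveHull (V : Type u) [AddCommGroup V] [Module A V] :
    ∃ (E : Type u) (_ : AddCommGroup E) (_ : Module A E) (ι : V →ₗ[A] E), IsInjectiveHull ι := by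
  obtain ⟨J, _, _, j, hJ, hj⟩ := exists_injective_embedding (A := A) V
  obtain ⟨E, hVE, hE⟩ := zorn_le_nonempty₀
    {E : Submodule A J | LinearMap.range j ≤ E ∧
      ∀ N ≤ E, N ⊓ LinearMap.range j = ⊥ → N = ⊥} (by
    intro c hc hchain E₀ hE₀
    refine ⟨sSup c, ⟨(hc hE₀).1.trans (le_sSup hE₀), fun N hN hNV ↦ ?_⟩, fun _ ↦ le_sSup⟩
    rw [Submodule.eq_bot_iff]
    intro x hx
    obtain ⟨E, hE, hxE⟩ := (Submodule.mem_sSup_of_directed ⟨E₀, hE₀⟩ hchain.directedOn).1 (hN hx)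
    have h1 : N ⊓ E = ⊥ := (hc hE).2 _ inf_le_right (by
      rw [eq_bot_iff, ← hNV]
      exact inf_le_inf_right _ inf_le_left)
    exact (Submodule.mem_bot A).1 (h1 ▸ ⟨hx, hxE⟩)) (LinearMap.range j)
    ⟨le_rfl, fun N hN h ↦ by rwa [inf_eq_left.2 hN] at h⟩
  obtain ⟨C, -, hC⟩ := zorn_le_nonempty₀ {C : Submodule A J | C ⊓ E = ⊥} (by
    intro c hc hchain C₀ hC₀
    refine ⟨sSup c, ?_, fun _ ↦ le_sSup⟩
    change _ = _
    rw [Submodule.eq_bot_iff]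
    rintro x ⟨hx, hxE⟩
    obtain ⟨C, hC, hxC⟩ := (Submodule.mem_sSup_of_directed ⟨C₀, hC₀⟩ hchain.directedOn).1 hx
    exact (Submodule.mem_bot A).1 ((hc hC : C ⊓ E = ⊥) ▸ ⟨hxC, hxE⟩)) ⊥ (bot_inf_eq _)
  have hCE : C ⊓ E = ⊥ := hC.prop
  have hess : ∀ N : Submodule A (J ⧸ C), N ⊓ E.map C.mkQ = ⊥ → N = ⊥ := by
    intro N hN
    have h1 : N.comap C.mkQ ⊓ E = ⊥ := by
      rw [Submodule.eq_bot_iff]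
      rintro x ⟨hx, hxE⟩
      have h2 : C.mkQ x ∈ N ⊓ E.map C.mkQ := ⟨hx, Submodule.mem_map_of_mem hxE⟩
      rw [hN, Submodule.mem_bot, Submodule.mkQ_apply, Submodule.Quotient.mk_eq_zero] at h2
      exact (Submodule.mem_bot A).1 (hCE ▸ ⟨h2, hxE⟩)
    have h3 : N.comap C.mkQ ≤ C := hC.le_of_ge h1 (Submodule.le_comap_mkQ C N)
    rw [Submodule.eq_bot_iff]
    intro y hy
    obtain ⟨x, rfl⟩ := C.mkQ_surjective y
    exact (Submodule.Quotient.mk_eq_zero C).2 (h3 hy)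
  obtain ⟨g, hg⟩ := hJ.out (C.mkQ ∘ₗ E.subtype) (by
    rw [← LinearMap.ker_eq_bot, LinearMap.ker_comp, Submodule.ker_mkQ,
      ← Submodule.disjoint_iff_comap_eq_bot]
    exact (disjoint_iff.2 (by rw [inf_comm]; exact hCE))) E.subtype
  have hg' : ∀ e ∈ E, g (C.mkQ e) = e := fun e he ↦ hg ⟨e, he⟩
  have hEg : E ≤ LinearMap.range g := fun e he ↦ ⟨_, hg' e he⟩
  have hgE : LinearMap.range g ≤ E := hE.le_of_ge ⟨hVE.trans hEg, fun N hN hNV ↦ by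
    have h1 : N ⊓ E = ⊥ := hE.prop.2 _ inf_le_right (by
      rw [eq_bot_iff, ← hNV]
      exact inf_le_inf_right _ inf_le_left)
    have h2 : N.comap g = ⊥ := hess _ (by
      rw [Submodule.eq_bot_iff]
      rintro _ ⟨hx, e, he, rfl⟩
      have h3 : e ∈ N := by
        have h4 : g (C.mkQ e) ∈ N := hx
        rwa [hg' e he] at h4
      have h5 : e = 0 := (Submodule.mem_bot A).1 (h1 ▸ ⟨h3, he⟩)
      rw [h5, map_zero])
    rw [Submodule.eq_bot_iff]
    intro x hx
    obtain ⟨y, rfl⟩ := hN hx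
    have h3 : y ∈ N.comap g := hx
    rw [h2, Submodule.mem_bot] at h3
    rw [h3, map_zero]⟩ hEg
  refine ⟨E, inferInstance, inferInstance, j.codRestrict E fun v ↦ hVE ⟨v, rfl⟩, ?_, ?_, ?_⟩
  · exact hJ.of_retract E.subtype
      ((g ∘ₗ C.mkQ).codRestrict E fun x ↦ hgE ⟨_, rfl⟩) fun x ↦ Subtype.ext (hg' x x.2)
  · exact fun x y h ↦ hj (congrArg Subtype.val h)
  · intro N hN
    have h1 : N.map E.subtype = ⊥ := hE.prop.2 _ (Submodule.map_subtype_le _ _) (by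
      rw [Submodule.eq_bot_iff]
      rintro _ ⟨⟨y, hy, rfl⟩, v, hv⟩
      have h2 : y ∈ N ⊓ LinearMap.range (j.codRestrict E fun v ↦ hVE ⟨v, rfl⟩) :=
        ⟨hy, v, Subtype.ext hv⟩
      rw [hN, Submodule.mem_bot] at h2
      rw [h2, map_zero])
    exact Submodule.map_injective_of_injective E.injective_subtype (by rw [h1, Submodule.map_bot])

end InjectiveHull

section RightModules

theorem rsmul_mul {A M : Type*} [Monoid A] [MulAction Aᵐᵒᵖ M] (m : M) (a b : A) :
    m <• (a * b) = m <• a <• b := by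
  rw [MulOpposite.op_mul, mul_smul]

theorem mem_span_rsmul_singleton {A M : Type*} [Ring A] [AddCommGroup M] [Module Aᵐᵒᵖ M]
    {x y : M} : y ∈ Submodule.span Aᵐᵒᵖ {x} ↔ ∃ s : A, y = x <• s := by
  rw [Submodule.mem_span_singleton]
  exact ⟨fun ⟨s, hs⟩ ↦ ⟨s.unop, hs.symm⟩, fun ⟨s, hs⟩ ↦ ⟨MulOpposite.op s, hs.symm⟩⟩

/-- The homomorphism of right modules `A → M`, `s ↦ m s`. -/
def rightOrbit (A : Type*) {M : Type*} [Ring A] [AddCommGroup M] [Module Aᵐᵒᵖ M] (m : M) :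
    A →ₗ[Aᵐᵒᵖ] M where
  toFun s := m <• s
  map_add' a b := by rw [MulOpposite.op_add, add_smul]
  map_smul' c a := rsmul_mul m a c.unop

@[simp]
theorem rightOrbit_apply {A M : Type*} [Ring A] [AddCommGroup M] [Module Aᵐᵒᵖ M] (m : M) (s : A) :
    rightOrbit A m s = m <• s := rfl

/-- Injective right modules are divisible. -/
theorem Module.Injective.exists_rsmul_eq {A E : Type u} [Ring A] [AddCommGroup E] [Module Aᵐᵒᵖ E]
    (hE : Module.Injective Aᵐᵒᵖ E) {a : A} (ha : IsLeftRegular a) (m : E) :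
    ∃ y : E, y <• a = m := by
  obtain ⟨h, hh⟩ := hE.out (LinearMap.mulLeft Aᵐᵒᵖ a) ha (rightOrbit A m)
  refine ⟨h 1, ?_⟩
  have h1 := hh 1
  rw [rightOrbit_apply, MulOpposite.op_one, one_smul, LinearMap.mulLeft_apply, mul_one] at h1
  rw [← map_smul, ← h1]
  exact congrArg h (one_mul a)

theorem exists_rsmul_mem_range_of_ne_zero {A V E : Type u} [Ring A] [AddCommGroup V]
    [Module Aᵐᵒᵖ V] [AddCommGroup E] [Module Aᵐᵒᵖ E] {ι : V →ₗ[Aᵐᵒᵖ] E} (hι : IsInjectiveHull ι)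
    {y : E} (hy : y ≠ 0) : ∃ (s : A) (v : V), y <• s = ι v ∧ v ≠ 0 := by
  by_contra! H
  refine hy (Submodule.span_singleton_eq_bot.1 (hι.essential (Submodule.span Aᵐᵒᵖ {y}) ?_))
  rw [Submodule.eq_bot_iff]
  rintro _ ⟨hx, v, rfl⟩
  obtain ⟨s, hs⟩ := mem_span_rsmul_singleton.1 hx
  rw [H s v hs.symm, map_zero]

end RightModules

section XAction

open SkewPoly

variable {k : Type v} {R : Type u} [Field k] [CommRing R] [IsDomain R]
  [IsDiscreteValuationRing R] [Algebra k R]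
  (α : R ≃ₐ[k] R) {X : R} (hX : IsLocalRing.maximalIdeal R = Ideal.span {X})

section Module

variable {M : Type*} [AddCommGroup M] [Module (RingS α)ᵐᵒᵖ M]

/-- The submodule `M Xⁿ`. -/
def rangeX (hX : IsLocalRing.maximalIdeal R = Ideal.span {X}) (M : Type*) [AddCommGroup M]
    [Module (RingS α)ᵐᵒᵖ M] (n : ℕ) : Submodule (RingS α)ᵐᵒᵖ M where
  carrier := {m | ∃ m' : M, m' <• constS α X ^ n = m}
  zero_mem' := ⟨0, smul_zero _⟩
  add_mem' := by
    rintro _ _ ⟨a, rfl⟩ ⟨b, rfl⟩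
    exact ⟨a + b, smul_add _ _ _⟩
  smul_mem' := by
    rintro s _ ⟨a, rfl⟩
    obtain ⟨s', hs'⟩ := exists_pow_X_mul_eq α hX s.unop n
    exact ⟨a <• s', by rw [← rsmul_mul, ← hs', rsmul_mul]; rfl⟩

/-- The submodule of the elements annihilated by `Xⁿ`. -/
def kerX (hX : IsLocalRing.maximalIdeal R = Ideal.span {X}) (M : Type*) [AddCommGroup M]
    [Module (RingS α)ᵐᵒᵖ M] (n : ℕ) : Submodule (RingS α)ᵐᵒᵖ M where
  carrier := {m | m <• constS α X ^ n = 0}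
  zero_mem' := smul_zero _
  add_mem' := by
    intro a b (ha : a <• _ = 0) (hb : b <• _ = 0)
    change (a + b) <• _ = 0
    rw [smul_add, ha, hb, add_zero]
  smul_mem' := by
    intro s a (ha : a <• _ = 0)
    obtain ⟨s', hs'⟩ := exists_mul_pow_X_eq α hX s.unop n
    change (a <• s.unop) <• _ = 0
    rw [← rsmul_mul, hs', rsmul_mul, ha, smul_zero]

omit [IsDomain R] [IsDiscreteValuationRing R] in
theorem eq_zero_of_rsmul_pow_X_eq_zero (hinj : ∀ m : M, m <• constS α X = 0 → m = 0) (n : ℕ)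
    {m : M} (h : m <• constS α X ^ n = 0) : m = 0 := by
  induction n with
  | zero => simpa using h
  | succ n ih => exact ih (hinj _ (by rwa [← rsmul_mul, ← pow_succ]))

omit [IsDomain R] [IsDiscreteValuationRing R] in
theorem rsmul_X_injective (hinj : ∀ m : M, m <• constS α X = 0 → m = 0) {a b : M}
    (h : a <• constS α X = b <• constS α X) : a = b :=
  sub_eq_zero.1 (hinj _ (by rw [smul_sub, h, sub_self]))

include hX

/-- An Artinian `S`-module without `X`-torsion is `X`-divisible. -/
theorem exists_rsmul_X_eq_of_isArtinian [IsArtinian (RingS α)ᵐᵒᵖ M]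
    (hinj : ∀ m : M, m <• constS α X = 0 → m = 0) (m : M) : ∃ m' : M, m' <• constS α X = m := by
  obtain ⟨n, hn⟩ := IsArtinian.monotone_stabilizes
    (⟨fun n ↦ OrderDual.toDual (rangeX α hX M n), monotone_nat_of_le_succ fun n ↦ by
      rintro _ ⟨a, rfl⟩
      exact ⟨a <• constS α X, by rw [← rsmul_mul, ← pow_succ']⟩⟩ :
      ℕ →o (Submodule (RingS α)ᵐᵒᵖ M)ᵒᵈ)
  have h1 : rangeX α hX M n = rangeX α hX M (n + 1) := hn (n + 1) (Nat.le_succ n)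
  obtain ⟨m', hm'⟩ : m <• constS α X ^ n ∈ rangeX α hX M (n + 1) := h1 ▸ ⟨m, rfl⟩
  refine ⟨m', ?_⟩
  rw [← sub_eq_zero]
  apply eq_zero_of_rsmul_pow_X_eq_zero α hinj n
  rw [smul_sub, ← rsmul_mul, ← pow_succ', hm', sub_self]

theorem exists_mem_rsmul_X_eq_of_isArtinian (hinj : ∀ m : M, m <• constS α X = 0 → m = 0)
    (N : Submodule (RingS α)ᵐᵒᵖ M) [IsArtinian (RingS α)ᵐᵒᵖ N] {m : M} (hm : m ∈ N) :
    ∃ m' ∈ N, m' <• constS α X = m := by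
  obtain ⟨m', h⟩ := exists_rsmul_X_eq_of_isArtinian α hX (M := N)
    (fun a ha ↦ Subtype.ext (hinj a (congrArg Subtype.val ha))) ⟨m, hm⟩
  exact ⟨m', m'.2, congrArg Subtype.val h⟩

theorem mem_of_rsmul_X_mem (hinj : ∀ m : M, m <• constS α X = 0 → m = 0)
    (N : Submodule (RingS α)ᵐᵒᵖ M) [IsArtinian (RingS α)ᵐᵒᵖ N] {m : M}
    (hm : m <• constS α X ∈ N) : m ∈ N := by
  obtain ⟨m', hm', h⟩ := exists_mem_rsmul_X_eq_of_isArtinian α hX hinj N hm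
  rwa [← rsmul_X_injective α hinj h]

end Module

include hX

/-- If the simple module `V` is not annihilated by `X` then its injective hull has no
`X`-torsion. -/
theorem eq_zero_of_rsmul_X_eq_zero_of_hull {V E : Type u} [AddCommGroup V]
    [Module (RingS α)ᵐᵒᵖ V] [AddCommGroup E] [Module (RingS α)ᵐᵒᵖ E] {ι : V →ₗ[(RingS α)ᵐᵒᵖ] E}
    [IsSimpleModule (RingS α)ᵐᵒᵖ V] (hι : IsInjectiveHull ι) {v : V}
    (hv : v <• constS α X ≠ 0) (e : E) (he : e <• constS α X = 0) : e = 0 := by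
  have hV : kerX α hX V 1 = ⊥ := (eq_bot_or_eq_top _).resolve_right fun h ↦ hv (by
    have h1 : v ∈ kerX α hX V 1 := h ▸ Submodule.mem_top
    simpa [kerX] using h1)
  have hE : kerX α hX E 1 = ⊥ := hι.essential _ (by
    rw [Submodule.eq_bot_iff]
    rintro _ ⟨hx, v, rfl⟩
    have h1 : v ∈ kerX α hX V 1 := hι.injective_map (by
      rw [map_smul, map_zero]
      exact hx)
    rw [hV, Submodule.mem_bot] at h1
    rw [h1, map_zero])
  have h1 : e ∈ kerX α hX E 1 := by simpa [kerX] using he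
  rwa [hE, Submodule.mem_bot] at h1

variable (hk : Function.Bijective (algebraMap k (IsLocalRing.ResidueField R)))

include hk

theorem exists_eq_add_of_rightDiamond (hS : RightDiamond (RingS α)) {w z : RingS α}
    (hw : Irreducible w) (hw1 : reduce hk α w = 1) (hz : Irreducible z)
    (hzd : 0 < (reduce hk α z).natDegree) (b : RingS α) : ∃ c d, b = w * c + d * z := by
  have hz0 : reduce hk α z ≠ 0 := by rintro h; simp [h] at hzd
  have hw0 : reduce hk α w ≠ 0 := by rw [hw1]; exact one_ne_zero
  set I := Submodule.span (RingS α)ᵐᵒᵖ {w}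
  have hcoatom : IsCoatom I := isCoatom_span_of_irreducible hk α hX hw hw1
  have : IsSimpleModule (RingS α)ᵐᵒᵖ (RingS α ⧸ I) := isSimpleModule_iff_isCoatom.2 hcoatom
  obtain ⟨E, _, _, ι, hι⟩ := exists_isInjectiveHull (A := (RingS α)ᵐᵒᵖ) (RingS α ⧸ I)
  have hinj : ∀ e : E, e <• constS α X = 0 → e = 0 :=
    eq_zero_of_rsmul_X_eq_zero_of_hull α hX hι (v := I.mkQ 1) fun h ↦ by
      rw [← map_smul, Submodule.mkQ_apply, Submodule.Quotient.mk_eq_zero] at h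
      obtain ⟨c, hc⟩ := mem_span_op_singleton.1
        (mem_span_of_mul_X_mem hk α hX hw0 (s := 1) (by rw [one_mul]; simpa using h))
      exact hw.not_isUnit (IsUnit.of_mul_eq_one c hc.symm)
  obtain ⟨y, hy⟩ := hι.injective_module.exists_rsmul_eq
    (IsLeftCancelMulZero.mul_left_cancel_of_ne_zero hz.ne_zero) (ι (I.mkQ b))
  have he : ∀ s : RingS α, ι (I.mkQ 1) <• s = ι (I.mkQ s) := fun s ↦ by
    rw [← map_smul, ← map_smul]
    exact congrArg (fun t ↦ ι (I.mkQ t)) (one_mul s)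
  set J : Submodule (RingS α)ᵐᵒᵖ (RingS α) :=
    (LinearMap.range ι).comap (rightOrbit (RingS α) y)
  have hsat : ∀ s, s * constS α X ∈ J → s ∈ J := by
    rintro s ⟨v, hv⟩
    obtain ⟨t, rfl⟩ := I.mkQ_surjective v
    obtain ⟨c, d, rfl⟩ := exists_eq_add_mul_X hk α hX hw1 1 t
    refine ⟨I.mkQ d, rsmul_X_injective α hinj ?_⟩
    have hwc : I.mkQ (w * c) = 0 :=
      (Submodule.Quotient.mk_eq_zero I).2 (mem_span_op_singleton.2 ⟨c, rfl⟩)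
    rw [rightOrbit_apply, rsmul_mul] at hv
    rw [rightOrbit_apply, ← hv, ← he d, ← rsmul_mul, he, map_add I.mkQ, hwc, pow_one, zero_add]
  rcases eq_span_or_eq_top_of_irreducible hk α hX hz hsat ⟨I.mkQ b, hy.symm⟩ with h | h
  · exfalso
    have hN := hS _ E ι this hι (Submodule.span _ {ι (I.mkQ 1), y})
      (Submodule.fg_span (Set.toFinite _))
    obtain ⟨y', hy', hyX⟩ := exists_mem_rsmul_X_eq_of_isArtinian α hX hinj
      (Submodule.span _ {ι (I.mkQ 1), y}) (m := y) (Submodule.subset_span (by simp))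
    obtain ⟨a, c, rfl⟩ := Submodule.mem_span_pair.1 hy'
    have h1 : 1 - c.unop * constS α X ∈ J := by
      refine ⟨I.mkQ (a.unop * constS α X), ?_⟩
      rw [← he, map_sub, rightOrbit_apply, rightOrbit_apply, rsmul_mul, rsmul_mul,
        MulOpposite.op_one, one_smul, eq_sub_iff_add_eq, ← smul_add]
      exact hyX
    rw [h] at h1
    obtain ⟨q, hq⟩ := mem_span_op_singleton.1 h1
    have h2 : reduce hk α z * reduce hk α q = 1 := by
      rw [← map_mul, ← hq, map_sub, map_mul, reduce_X hk α hX, mul_zero, sub_zero, map_one]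
    exact hzd.ne' (Polynomial.natDegree_eq_zero_of_isUnit (IsUnit.of_mul_eq_one _ h2))
  · obtain ⟨v, hv⟩ : (1 : RingS α) ∈ J := h ▸ Submodule.mem_top
    obtain ⟨d, rfl⟩ := I.mkQ_surjective v
    rw [rightOrbit_apply, MulOpposite.op_one, one_smul] at hv
    rw [← hv, ← he, ← rsmul_mul, he] at hy
    obtain ⟨c, hc⟩ := mem_span_op_singleton.1
      ((Submodule.Quotient.eq I).1 (hι.injective_map hy.symm))
    exact ⟨c, d, sub_eq_iff_eq_add.1 hc⟩

end XAction

section Torsion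

open SkewPoly

/-- If a nilpotent endomorphism of a vector space has finite-dimensional kernel then the space is
finite-dimensional. -/
theorem Module.finite_of_fg_ker_of_pow_eq_zero {k M : Type*} [Field k] [AddCommGroup M] [Module k M]
    (f : M →ₗ[k] M) (hf : (LinearMap.ker f).FG) {n : ℕ} (hn : f ^ n = 0) : Module.Finite k M := by
  have key : ∀ n, (LinearMap.ker (f ^ n)).FG := by
    intro n
    induction n with
    | zero =>
      rw [pow_zero, Module.End.one_eq_id, LinearMap.ker_id]
      exact Submodule.fg_bot
    | succ n ih =>
      refine Submodule.fg_of_fg_map_of_fg_inf_ker f ?_ ?_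
      · refine ih.of_le ?_
        rintro _ ⟨x, hx, rfl⟩
        have h1 : (f ^ (n + 1)) x = 0 := hx
        rw [pow_succ] at h1
        exact h1
      · exact hf.of_le inf_le_right
  have := key n
  rw [hn, LinearMap.ker_zero] at this
  exact ⟨this⟩

variable {k : Type v} {R : Type u} [Field k] [CommRing R] [IsDomain R]
  [IsDiscreteValuationRing R] [Algebra k R]
  (α : R ≃ₐ[k] R) {X : R} (hX : IsLocalRing.maximalIdeal R = Ideal.span {X})

include hX in
/-- A Noetherian module in which the annihilator of `X` is essential is annihilated by a power
of `X`. -/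
theorem exists_rsmul_pow_X_eq_zero {M : Type*} [AddCommGroup M] [Module (RingS α)ᵐᵒᵖ M]
    [IsNoetherian (RingS α)ᵐᵒᵖ M]
    (hess : ∀ N : Submodule (RingS α)ᵐᵒᵖ M, N ⊓ kerX α hX M 1 = ⊥ → N = ⊥) :
    ∃ n, ∀ m : M, m <• constS α X ^ n = 0 := by
  obtain ⟨n, hn⟩ := monotone_stabilizes_iff_noetherian.2 ‹IsNoetherian (RingS α)ᵐᵒᵖ M›
    ⟨kerX α hX M, monotone_nat_of_le_succ fun n m (hm : m <• _ = 0) ↦ by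
      change m <• _ = 0
      rw [pow_succ, rsmul_mul, hm, smul_zero]⟩
  have h0 : rangeX α hX M n = ⊥ := hess _ (by
    rw [Submodule.eq_bot_iff]
    rintro _ ⟨⟨m, rfl⟩, hm⟩
    have h1 : m ∈ kerX α hX M (n + 1) := by
      change m <• _ = 0
      rw [pow_succ, rsmul_mul]
      simpa [kerX] using hm
    have h2 : kerX α hX M n = kerX α hX M (n + 1) := hn (n + 1) (Nat.le_succ n)
    rw [← h2] at h1
    exact h1)
  refine ⟨n, fun m ↦ ?_⟩
  have h1 : m <• constS α X ^ n ∈ rangeX α hX M n := ⟨m, rfl⟩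
  rwa [h0, Submodule.mem_bot] at h1

variable (hk : Function.Bijective (algebraMap k (IsLocalRing.ResidueField R)))

include hX in
theorem rsmul_eq_of_reduce_eq {M : Type*} [AddCommGroup M] [Module (RingS α)ᵐᵒᵖ M] {y : M}
    (hy : y <• constS α X = 0) {s t : RingS α} (h : reduce hk α s = reduce hk α t) :
    y <• s = y <• t := by
  obtain ⟨q, hq⟩ := (reduce_eq_zero_iff hk α hX (p := s - t)).1 (by rw [map_sub, h, sub_self])
  rw [sub_eq_iff_eq_add.1 hq, MulOpposite.op_add, add_smul, rsmul_mul, hy, smul_zero, zero_add]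

include hX in
theorem exists_reduce_ne_zero_rsmul_eq_zero {V E : Type u} [AddCommGroup V]
    [Module (RingS α)ᵐᵒᵖ V] [AddCommGroup E] [Module (RingS α)ᵐᵒᵖ E] {ι : V →ₗ[(RingS α)ᵐᵒᵖ] E}
    [IsSimpleModule (RingS α)ᵐᵒᵖ V] (hι : IsInjectiveHull ι)
    {y : E} (hy : y <• constS α X = 0) : ∃ s : RingS α, reduce hk α s ≠ 0 ∧ y <• s = 0 := by
  by_cases hy0 : y = 0
  · exact ⟨1, by simp, by rw [hy0, smul_zero]⟩
  obtain ⟨s, v, hs, hv⟩ := exists_rsmul_mem_range_of_ne_zero hι hy0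
  have hs0 : reduce hk α s ≠ 0 := fun h ↦ hv (hι.injective_map (by
    rw [map_zero, ← hs, rsmul_eq_of_reduce_eq α hX hk hy (h.trans (map_zero _).symm),
      MulOpposite.op_zero, zero_smul]))
  by_cases hvθ : v <• θ (α : R ≃+* R) = 0
  · refine ⟨s * θ _, ?_, by rw [rsmul_mul, hs, ← map_smul, hvθ, map_zero]⟩
    rw [map_mul, reduce_θ]
    exact mul_ne_zero hs0 Polynomial.X_ne_zero
  · have h1 : v ∈ Submodule.span (RingS α)ᵐᵒᵖ {v <• θ (α : R ≃+* R)} := by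
      rw [(eq_bot_or_eq_top (Submodule.span (RingS α)ᵐᵒᵖ {v <• θ (α : R ≃+* R)})).resolve_left
        (mt Submodule.span_singleton_eq_bot.1 hvθ)]
      exact Submodule.mem_top
    obtain ⟨t, ht⟩ := mem_span_rsmul_singleton.1 h1
    refine ⟨s * (1 - θ _ * t), ?_, ?_⟩
    · rw [map_mul, map_sub, map_mul, reduce_θ, map_one]
      refine mul_ne_zero hs0 fun h ↦ ?_
      have := congrArg (Polynomial.eval 0) h
      simp at this
    · rw [rsmul_mul, hs, ← map_smul, MulOpposite.op_sub, sub_smul, rsmul_mul, ← ht,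
        MulOpposite.op_one, one_smul, sub_self, map_zero]

section FiniteDimensional

variable {M : Type*} [AddCommGroup M] [Module (RingS α)ᵐᵒᵖ M] [Module k M]
  (hkM : ∀ (c : k) (m : M), c • m = m <• constS α (algebraMap k R c))

include hX hkM hk

theorem exists_fg_forall_rsmul_mem {y : M} (hy : y <• constS α X = 0) {s : RingS α}
    (hs : reduce hk α s ≠ 0) (hys : y <• s = 0) :
    ∃ W : Submodule k M, W.FG ∧ ∀ t : RingS α, y <• t ∈ W := by
  let Φ : Polynomial k →ₗ[k] M :=
    { toFun := fun f ↦ y <• polyToS α f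
      map_add' := fun f g ↦ by
        rw [← add_smul, ← MulOpposite.op_add]
        exact rsmul_eq_of_reduce_eq α hX hk hy (by simp)
      map_smul' := fun c f ↦ by
        rw [hkM, ← rsmul_mul]
        refine rsmul_eq_of_reduce_eq α hX hk hy ?_
        rw [RingHom.id_apply, map_mul, reduce_polyToS, reduce_polyToS, reduce_constS,
          residueToField_algebraMap, mul_comm, Polynomial.smul_eq_C_mul] }
  set n := (reduce hk α s).natDegree + 1
  refine ⟨(Polynomial.degreeLT k n).map Φ, ?_, fun t ↦ ?_⟩
  · have : Module.Finite k (Polynomial.degreeLT k n) :=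
      Module.Finite.equiv (Polynomial.degreeLTEquiv k n).symm
    exact (Module.Finite.iff_fg.1 this).map Φ
  · refine ⟨reduce hk α t % reduce hk α s, ?_, ?_⟩
    · rw [SetLike.mem_coe, Polynomial.mem_degreeLT]
      refine (Polynomial.degree_mod_lt _ hs).trans_le (Polynomial.degree_le_natDegree.trans ?_)
      exact_mod_cast Nat.le_succ _
    · change y <• polyToS α _ = _
      have h1 : reduce hk α t = reduce hk α (polyToS α (reduce hk α t % reduce hk α s) +
          s * polyToS α (reduce hk α t / reduce hk α s)) := by
        rw [map_add, map_mul, reduce_polyToS, reduce_polyToS, EuclideanDomain.mod_add_div]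
      rw [rsmul_eq_of_reduce_eq α hX hk hy h1, MulOpposite.op_add, add_smul, rsmul_mul, hys,
        smul_zero, add_zero]

theorem isArtinian_of_forall_exists_rsmul_eq_zero [IsNoetherian (RingS α)ᵐᵒᵖ M]
    (hess : ∀ N : Submodule (RingS α)ᵐᵒᵖ M, N ⊓ kerX α hX M 1 = ⊥ → N = ⊥)
    (htors : ∀ y : M, y <• constS α X = 0 → ∃ s : RingS α, reduce hk α s ≠ 0 ∧ y <• s = 0) :
    IsArtinian (RingS α)ᵐᵒᵖ M := by
  obtain ⟨n, hn⟩ := exists_rsmul_pow_X_eq_zero α hX hess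
  have key : ∀ N : Submodule (RingS α)ᵐᵒᵖ M, N.FG → N ≤ kerX α hX M 1 →
      ∃ W : Submodule k M, W.FG ∧ ∀ y ∈ N, y ∈ W := by
    intro N hN
    induction N, hN using Submodule.fg_induction with
    | singleton y =>
      intro hy
      have hy : y <• constS α X = 0 := by
        simpa [kerX] using hy (Submodule.mem_span_singleton_self y)
      obtain ⟨s, hs, hys⟩ := htors y hy
      obtain ⟨W, hW, h⟩ := exists_fg_forall_rsmul_mem α hX hk hkM hy hs hys
      refine ⟨W, hW, fun z hz ↦ ?_⟩
      obtain ⟨t, rfl⟩ := mem_span_rsmul_singleton.1 hz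
      exact h t
    | sup N₁ N₂ h₁ h₂ ih₁ ih₂ =>
      intro hle
      obtain ⟨W₁, hW₁, h₁⟩ := ih₁ (le_sup_left.trans hle)
      obtain ⟨W₂, hW₂, h₂⟩ := ih₂ (le_sup_right.trans hle)
      refine ⟨W₁ ⊔ W₂, hW₁.sup hW₂, fun y hy ↦ ?_⟩
      obtain ⟨a, ha, b, hb, rfl⟩ := Submodule.mem_sup.1 hy
      exact Submodule.add_mem_sup (h₁ a ha) (h₂ b hb)
  obtain ⟨W, hW, hWker⟩ := key (kerX α hX M 1) (IsNoetherian.noetherian _) le_rfl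
  let f : M →ₗ[k] M :=
    { toFun := fun m ↦ m <• constS α X
      map_add' := fun a b ↦ smul_add _ _ _
      map_smul' := fun c m ↦ by
        rw [RingHom.id_apply, hkM, hkM, ← rsmul_mul, ← rsmul_mul, ← map_mul, ← map_mul, mul_comm] }
  have hf : ∀ n m, (f ^ n) m = m <• constS α X ^ n := by
    intro n
    induction n with
    | zero => intro m; simp
    | succ n ih =>
      intro m
      rw [pow_succ', Module.End.mul_apply, ih, pow_succ, rsmul_mul]
      rfl
  have hfin : Module.Finite k M := Module.finite_of_fg_ker_of_pow_eq_zero f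
    (hW.of_le fun m hm ↦ hWker m (by
      change m <• _ = 0
      rw [pow_one]
      exact hm)) (n := n) (LinearMap.ext fun m ↦ (hf n m).trans (hn m))
  have hart : IsArtinian k M := inferInstance
  rw [isArtinian_iff] at hart ⊢
  let g : Submodule (RingS α)ᵐᵒᵖ M → Submodule k M := fun N ↦
    { N.toAddSubmonoid with
      smul_mem' := fun c m hm ↦ by
        rw [hkM]
        exact N.smul_mem _ hm }
  have hg : StrictMono g := fun N N' h ↦ h
  exact Subrelation.wf (fun h ↦ hg h) (InvImage.wf g hart)

end FiniteDimensional

/-- Injective hulls of the simple modules annihilated by `X` are locally Artinian. -/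
theorem isLocallyArtinian_of_rsmul_X_eq_zero {V E : Type u} [AddCommGroup V]
    [Module (RingS α)ᵐᵒᵖ V] [AddCommGroup E] [Module (RingS α)ᵐᵒᵖ E] {ι : V →ₗ[(RingS α)ᵐᵒᵖ] E}
    [IsSimpleModule (RingS α)ᵐᵒᵖ V] (hι : IsInjectiveHull ι)
    (hX : IsLocalRing.maximalIdeal R = Ideal.span {X})
    (hk : Function.Bijective (algebraMap k (IsLocalRing.ResidueField R)))
    (hV : ∀ v : V, v <• constS α X = 0) : IsLocallyArtinian (RingS α)ᵐᵒᵖ E := by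
  intro N hN
  have : Module.Finite (RingS α)ᵐᵒᵖ N := Module.Finite.iff_fg.2 hN
  have : IsNoetherian (RingS α)ᵐᵒᵖ N := isNoetherian_of_isNoetherianRing_of_finite _ _
  let φ : k →+* (RingS α)ᵐᵒᵖ := ((SkewPoly.C (α : R ≃+* R)).comp (algebraMap k R)).toOpposite
    fun a b ↦ by
      change _ * _ = _ * _
      rw [← map_mul, ← map_mul, mul_comm]
  let _ : Module k N := Module.compHom N φ
  refine isArtinian_of_forall_exists_rsmul_eq_zero α hX hk (M := N) (fun _ _ ↦ rfl) ?_ ?_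
  · intro N' hN'
    have h1 : N'.map N.subtype = ⊥ := hι.essential _ (by
      rw [Submodule.eq_bot_iff]
      rintro _ ⟨⟨m, hm, rfl⟩, v, hv⟩
      have h2 : m ∈ N' ⊓ kerX α hX N 1 := ⟨hm, by
        change m <• _ = 0
        apply Subtype.ext
        change (m : E) <• _ = 0
        rw [pow_one, ← Submodule.subtype_apply, ← hv, ← map_smul, hV, map_zero]⟩
      rw [hN', Submodule.mem_bot] at h2
      rw [h2, map_zero])
    exact Submodule.map_injective_of_injective N.injective_subtype (by rw [h1, Submodule.map_bot])
  · intro y hy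
    obtain ⟨s, hs, h⟩ := exists_reduce_ne_zero_rsmul_eq_zero α hX hk hι (y := (y : E))
      (congrArg Subtype.val hy)
    exact ⟨s, hs, Subtype.ext h⟩

end Torsion

section TorsionFree

open SkewPoly

theorem SkewPoly.exists_eq_C_add_mul_θ {A : Type u} [Ring A] {σ : A ≃+* A} (p : SkewPoly σ) :
    ∃ q, p = C σ (coeff 0 p) + q * θ σ := by
  induction p using SkewPoly.induction_on with
  | h0 => exact ⟨0, by simp⟩
  | hadd p q hp hq =>
    obtain ⟨a, ha⟩ := hp
    obtain ⟨b, hb⟩ := hq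
    refine ⟨a + b, ?_⟩
    rw [map_add, map_add, add_mul, add_add_add_comm, ← ha, ← hb]
  | hmon a n =>
    cases n with
    | zero => exact ⟨0, by simp [coeff_C]⟩
    | succ n => exact ⟨C σ a * θ σ ^ n, by
        rw [coeff_C_mul_θ_pow, if_neg (Nat.succ_ne_zero n), map_zero, zero_add, pow_succ,
          mul_assoc]⟩

variable {k : Type v} {R : Type u} [Field k] [CommRing R] [IsDomain R]
  [IsDiscreteValuationRing R] [Algebra k R]
  (α : R ≃ₐ[k] R) {X : R} (hX : IsLocalRing.maximalIdeal R = Ideal.span {X})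
  (hk : Function.Bijective (algebraMap k (IsLocalRing.ResidueField R)))

theorem exists_eq_mul_add_mul_θ {w : RingS α} (hw : reduce hk α w = 1) (s : RingS α) :
    ∃ c d, s = w * c + d * θ _ := by
  obtain ⟨s', hs⟩ := exists_eq_C_add_mul_θ s
  obtain ⟨w', hw'⟩ := exists_eq_C_add_mul_θ w
  obtain ⟨u, hu⟩ : IsUnit (coeff 0 w) := (isUnit_iff_residueToField_ne_zero hk).2 (by
    rw [← coeff_reduce, hw, Polynomial.coeff_one_zero]
    exact one_ne_zero)
  set r : R := ↑u⁻¹ * coeff 0 s with hr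
  refine ⟨constS α r, s' - w' * constS α ((α : R ≃+* R) r), ?_⟩
  have h1 : constS α (coeff 0 w) * constS α r = constS α (coeff 0 s) := by
    rw [← map_mul, hr, ← hu, Units.mul_inv_cancel_left]
  have h2 : w * constS α r = constS α (coeff 0 s) + w' * constS α ((α : R ≃+* R) r) * θ _ := by
    conv_lhs => rw [hw']
    rw [add_mul, h1, mul_assoc, θ_mul_C, mul_assoc]
  rw [h2, sub_mul]
  conv_lhs => rw [hs]
  abel

include hX hk

/-- A right ideal `I` without `X`-torsion in the quotient, which is maximal in the sense that
`u s` generates for all `s ∉ I`, is generated by an element of type (B). -/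
theorem exists_isTypeB_generator {I : Submodule (RingS α)ᵐᵒᵖ (RingS α)} (h1 : (1 : RingS α) ∉ I)
    (hI : ∀ s, s * constS α X ∈ I → s ∈ I) (hmax : ∀ s ∉ I, ∃ t, 1 - s * t ∈ I)
    {r : RingS α} (hr : r ∈ I) (hr1 : reduce hk α r = 1) : ∃ w ∈ I, IsTypeB α X w := by
  have h0 : I ≠ ⊥ := by
    rintro rfl
    rw [(Submodule.mem_bot _).1 hr, map_zero] at hr1
    exact zero_ne_one hr1
  obtain ⟨w, -, rfl⟩ := exists_eq_span_singleton hk α hX h0 hI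
  obtain ⟨c, rfl⟩ := mem_span_op_singleton.1 hr
  rw [map_mul] at hr1
  obtain ⟨a, ha, hwa⟩ := Polynomial.isUnit_iff.1 (IsUnit.of_mul_eq_one _ hr1)
  have hau : IsUnit (constS α (algebraMap k R a)) := (ha.map _).map _
  set w' := w * constS α (algebraMap k R a⁻¹) with hw'
  have hww' : w' * constS α (algebraMap k R a) = w := by
    rw [hw', mul_assoc, ← map_mul, ← map_mul, inv_mul_cancel₀ ha.ne_zero, map_one, map_one,
      mul_one]
  have hmem : ∀ s, s ∈ Submodule.span (RingS α)ᵐᵒᵖ {w} → ∃ t, s = w' * t := fun s hs ↦ by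
    obtain ⟨t, rfl⟩ := mem_span_op_singleton.1 hs
    exact ⟨constS α (algebraMap k R a) * t, by rw [← mul_assoc, hww']⟩
  have hw'I : w' ∈ Submodule.span (RingS α)ᵐᵒᵖ {w} := mem_span_op_singleton.2 ⟨_, rfl⟩
  have hw'1 : reduce hk α w' = 1 := by
    rw [hw', map_mul, ← hwa, reduce_constS, residueToField_algebraMap, ← map_mul,
      mul_inv_cancel₀ ha.ne_zero, map_one]
  refine ⟨w', hw'I, IsTypeB.of_irreducible hk α hX ⟨?_, fun x y hxy ↦ ?_⟩ hw'1⟩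
  · rintro ⟨u, hu⟩
    refine h1 ?_
    have h2 : w' * ↑u⁻¹ ∈ Submodule.span (RingS α)ᵐᵒᵖ {w} :=
      Submodule.smul_mem _ (MulOpposite.op _) hw'I
    rwa [← hu, Units.mul_inv] at h2
  · by_cases hx : x ∈ Submodule.span (RingS α)ᵐᵒᵖ {w}
    · right
      obtain ⟨t, ht⟩ := hmem x hx
      have hx0 : x ≠ 0 := by
        rintro rfl
        rw [hxy, zero_mul, map_zero] at hw'1
        exact zero_ne_one hw'1
      refine IsUnit.of_mul_eq_one t (mul_left_cancel₀ hx0 ?_)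
      rw [← mul_assoc, ← hxy, ← ht, mul_one]
    · left
      obtain ⟨t, ht⟩ := hmax x hx
      obtain ⟨q, hq⟩ := hmem _ ht
      refine IsUnit.of_mul_eq_one (t + y * q) ?_
      rw [mul_add, ← mul_assoc, ← hxy, ← hq, add_sub_cancel]

/-- If `S = wS + Sz` for all `w` of type (B) then `z` acts surjectively on the `S`-modules of
finite length without `X`-torsion. -/
theorem exists_rsmul_eq_of_forall_isTypeB {M : Type*} [AddCommGroup M] [Module (RingS α)ᵐᵒᵖ M]
    [IsArtinian (RingS α)ᵐᵒᵖ M] [IsNoetherian (RingS α)ᵐᵒᵖ M]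
    (hinj : ∀ m : M, m <• constS α X = 0 → m = 0) {z : RingS α}
    (hz : ∀ w, IsTypeB α X w → ∀ s, ∃ c d, s = w * c + d * z) (m : M) :
    ∃ m' : M, m' <• z = m := by
  obtain ⟨P, hP, hPmax⟩ := set_has_maximal_iff_noetherian.2 ‹IsNoetherian (RingS α)ᵐᵒᵖ M›
    {P | ∀ p ∈ P, ∃ p' ∈ P, p' <• z = p} ⟨⊥, fun p hp ↦ ⟨0, Submodule.zero_mem _, by
      rw [(Submodule.mem_bot _).1 hp, smul_zero]⟩⟩
  by_cases hPtop : P = ⊤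
  · obtain ⟨p, -, hp⟩ := hP m (hPtop ▸ Submodule.mem_top)
    exact ⟨p, hp⟩
  exfalso
  obtain ⟨Q, hPQ, hQmin⟩ := IsArtinian.set_has_minimal {Q : Submodule (RingS α)ᵐᵒᵖ M | P < Q}
    ⟨⊤, lt_top_iff_ne_top.2 hPtop⟩
  have hPQ : P < Q := hPQ
  have hgen : ∀ u ∈ Q, u ∉ P → ∀ t ∈ Q, ∃ s : RingS α, t - u <• s ∈ P := by
    intro u hu huP t ht
    have hlt : P < P ⊔ Submodule.span _ {u} := left_lt_sup.2 fun h ↦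
      huP (h (Submodule.mem_span_singleton_self u))
    have h1 : ¬ P ⊔ Submodule.span _ {u} < Q := hQmin _ hlt
    have h2 : P ⊔ Submodule.span _ {u} = Q := (sup_le hPQ.le
      ((Submodule.span_singleton_le_iff_mem _ _).2 hu)).eq_of_not_lt h1
    rw [← h2] at ht
    obtain ⟨p, hp, y, hy, rfl⟩ := Submodule.mem_sup.1 ht
    obtain ⟨s, rfl⟩ := mem_span_rsmul_singleton.1 hy
    exact ⟨s, by rwa [add_sub_cancel_right]⟩
  obtain ⟨u, huQ, huP⟩ := SetLike.exists_of_lt hPQ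
  set I : Submodule (RingS α)ᵐᵒᵖ (RingS α) := P.comap (rightOrbit (RingS α) u)
  have hmemI : ∀ s, s ∈ I ↔ u <• s ∈ P := fun s ↦ Iff.rfl
  obtain ⟨u₁, hu₁, hu₁X⟩ := exists_mem_rsmul_X_eq_of_isArtinian α hX hinj Q huQ
  obtain ⟨s₁, hs₁⟩ := hgen u huQ huP u₁ hu₁
  obtain ⟨w, hwI, hw⟩ := exists_isTypeB_generator α hX hk (I := I)
    (by rwa [hmemI, MulOpposite.op_one, one_smul])
    (fun s hs ↦ mem_of_rsmul_X_mem α hX hinj P (by rwa [hmemI, rsmul_mul] at hs))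
    (fun s hs ↦ by
      obtain ⟨t, ht⟩ := hgen (u <• s) (Q.smul_mem _ huQ) hs u huQ
      exact ⟨t, by rwa [hmemI, MulOpposite.op_sub, sub_smul, MulOpposite.op_one, one_smul,
        rsmul_mul]⟩)
    (r := 1 - s₁ * constS α X) (by
      have h1 : (u₁ - u <• s₁) <• constS α X ∈ P := P.smul_mem _ hs₁
      rwa [hmemI, MulOpposite.op_sub, sub_smul, MulOpposite.op_one, one_smul, rsmul_mul, ← hu₁X,
        ← smul_sub, hu₁X])
    (by rw [map_sub, map_mul, reduce_X hk α hX, mul_zero, sub_zero, map_one])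
  refine hPmax Q (fun t ht ↦ ?_) hPQ
  obtain ⟨s, hs⟩ := hgen u huQ huP t ht
  obtain ⟨c, d, rfl⟩ := hz w hw s
  obtain ⟨p₁, hp₁, h₁⟩ := hP _ hs
  have h2 : u <• (w * c) ∈ P := by
    rw [rsmul_mul]
    exact P.smul_mem _ hwI
  obtain ⟨p₂, hp₂, h₂⟩ := hP _ h2
  refine ⟨p₁ + p₂ + u <• d, Q.add_mem (Q.add_mem (hPQ.le hp₁) (hPQ.le hp₂)) (Q.smul_mem _ huQ), ?_⟩
  rw [smul_add, smul_add, h₁, h₂, ← rsmul_mul, MulOpposite.op_add, add_smul]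
  abel

/-- If `y z` generates an Artinian submodule and `S/zS` is simple then `y` generates an Artinian
submodule. -/
theorem isArtinian_span_of_isArtinian_span_rsmul {E : Type u} [AddCommGroup E]
    [Module (RingS α)ᵐᵒᵖ E] {z : RingS α} (hz : Irreducible z) (hz1 : reduce hk α z = 1) {y : E}
    (P : Submodule (RingS α)ᵐᵒᵖ E) [IsArtinian (RingS α)ᵐᵒᵖ P] (hyz : y <• z ∈ P) :
    IsArtinian (RingS α)ᵐᵒᵖ (Submodule.span (RingS α)ᵐᵒᵖ {y}) := by
  have : IsSimpleModule (RingS α)ᵐᵒᵖ (RingS α ⧸ Submodule.span (RingS α)ᵐᵒᵖ {z}) :=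
    isSimpleModule_iff_isCoatom.2 (isCoatom_span_of_irreducible hk α hX hz hz1)
  set Y := Submodule.span (RingS α)ᵐᵒᵖ {y}
  have hyY : ∀ s : RingS α, y <• s ∈ Y := fun s ↦ mem_span_rsmul_singleton.2 ⟨s, rfl⟩
  set N := P.comap Y.subtype
  have hN : IsArtinian (RingS α)ᵐᵒᵖ N := isArtinian_of_injective
    ((Y.subtype ∘ₗ N.subtype).codRestrict P fun n ↦ n.2)
    fun a b h ↦ Subtype.ext (Subtype.ext (congrArg (fun p : P ↦ (p : E)) h))
  let ψ : (RingS α ⧸ Submodule.span (RingS α)ᵐᵒᵖ {z}) →ₗ[(RingS α)ᵐᵒᵖ] Y ⧸ N :=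
    Submodule.liftQ _ (N.mkQ ∘ₗ (rightOrbit (RingS α) y).codRestrict Y hyY) (by
      rw [Submodule.span_singleton_le_iff_mem]
      exact (Submodule.Quotient.mk_eq_zero N).2 hyz)
  have hψ : Function.Surjective ψ := by
    intro t
    obtain ⟨⟨t, ht⟩, rfl⟩ := N.mkQ_surjective t
    obtain ⟨s, rfl⟩ := mem_span_rsmul_singleton.1 ht
    exact ⟨Submodule.mkQ _ s, rfl⟩
  have : IsArtinian (RingS α)ᵐᵒᵖ (Y ⧸ N) := isArtinian_of_surjective _ ψ hψ
  exact (isArtinian_iff_submodule_quotient N).2 ⟨hN, this⟩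

/-- If `L` is closed under division by `X` and there are nonzero elements of `S` sending elements
outside `L` into `L`, then an irreducible such element of minimal degree can be found. -/
theorem exists_irreducible_rsmul_mem {E : Type u} [AddCommGroup E] [Module (RingS α)ᵐᵒᵖ E]
    {L : Submodule (RingS α)ᵐᵒᵖ E} (hL : ∀ e, e <• constS α X ∈ L → e ∈ L)
    (h : ∃ (y : E) (s : RingS α), y ∉ L ∧ s ≠ 0 ∧ y <• s ∈ L) :
    ∃ (y : E) (z : RingS α), y ∉ L ∧ y <• z ∈ L ∧ Irreducible z ∧ (reduce hk α z).Monic ∧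
      ∀ (e : E) (s : RingS α), e ∉ L → s ≠ 0 → e <• s ∈ L → degSucc z ≤ degSucc s := by
  obtain ⟨y₀, s₀, h₀⟩ := h
  obtain ⟨⟨y, r⟩, ⟨hy, hr0, hyr⟩, hmin⟩ :=
    (measure fun x : E × RingS α ↦ degSucc x.2).wf.has_min
      {x | x.1 ∉ L ∧ x.2 ≠ 0 ∧ x.1 <• x.2 ∈ L} ⟨(y₀, s₀), h₀⟩
  simp only at hy hr0 hyr
  obtain ⟨q, n, rfl, hq⟩ := exists_eq_mul_pow_X hk α hX hr0
  have hyq : y <• q ∈ L := by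
    rw [rsmul_mul] at hyr
    have key : ∀ n, ∀ e : E, e <• constS α X ^ n ∈ L → e ∈ L := by
      intro n
      induction n with
      | zero => exact fun e he ↦ by simpa using he
      | succ n ih => exact fun e he ↦ ih e (hL _ (by rwa [← rsmul_mul, ← pow_succ]))
    exact key n _ hyr
  set c := (reduce hk α q).leadingCoeff⁻¹ with hc
  have hc0 : algebraMap k R c ≠ 0 :=
    (map_ne_zero_iff _ (algebraMap k R).injective).2 (inv_ne_zero (by simpa using hq))
  set z := q * constS α (algebraMap k R c) with hz
  have hmonic : (reduce hk α z).Monic := by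
    rw [hz, map_mul, reduce_constS, residueToField_algebraMap]
    exact Polynomial.monic_mul_leadingCoeff_inv hq
  have hdeg : degSucc z = degSucc (q * constS α X ^ n) := by
    rw [hz, degSucc_mul_C _ hc0, ← map_pow,
      degSucc_mul_C _ (pow_ne_zero _ (uniformizer_ne_zero hX))]
  have hyz : y <• z ∈ L := by
    rw [hz, rsmul_mul]
    exact L.smul_mem _ hyq
  have hmin' : ∀ (e : E) (s : RingS α), e ∉ L → s ≠ 0 → e <• s ∈ L → degSucc z ≤ degSucc s := by
    intro e s he hs hes
    have := hmin (e, s) ⟨he, hs, hes⟩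
    rw [hdeg]
    exact not_lt.1 this
  have hz0 : z ≠ 0 := by
    intro h
    rw [h, map_zero] at hmonic
    exact hmonic.ne_zero rfl
  have hunit : ∀ a b : RingS α, z = a * b → degSucc a ≤ 1 ∨ degSucc b ≤ 1 →
      IsUnit a ∨ IsUnit b := by
    intro a b hab h
    have hred : reduce hk α a ≠ 0 ∧ reduce hk α b ≠ 0 := by
      rw [← mul_ne_zero_iff, ← map_mul, ← hab]
      exact hmonic.ne_zero
    refine h.imp (fun ha ↦ ?_) fun hb ↦ ?_
    · obtain ⟨r, rfl⟩ := degSucc_le_one_iff.1 ha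
      exact isUnit_constS_of_reduce_ne_zero hk α hred.1
    · obtain ⟨r, rfl⟩ := degSucc_le_one_iff.1 hb
      exact isUnit_constS_of_reduce_ne_zero hk α hred.2
  refine ⟨y, z, hy, hyz, ⟨?_, fun a b hab ↦ hunit a b hab ?_⟩, hmonic, hmin'⟩
  · rintro ⟨u, hu⟩
    refine hy ?_
    have h1 : (y <• z) <• (↑u⁻¹ : RingS α) ∈ L := L.smul_mem _ hyz
    rwa [← rsmul_mul, ← hu, Units.mul_inv, MulOpposite.op_one, one_smul] at h1
  · have hab0 : a ≠ 0 ∧ b ≠ 0 := by rw [← mul_ne_zero_iff, ← hab]; exact hz0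
    obtain ⟨m, hm⟩ := exists_degSucc_eq hab0.1
    obtain ⟨l, hl⟩ := exists_degSucc_eq hab0.2
    have hd := degSucc_mul hm hl
    rw [← hab] at hd
    by_cases ha : y <• a ∈ L
    · have := hmin' y a hy hab0.1 ha
      omega
    · have := hmin' (y <• a) b ha hab0.2 (by rwa [← rsmul_mul, ← hab])
      omega

/-- Injective hulls of the simple modules not annihilated by `X` are locally Artinian if
`S = wS + Sz` for all `w` of type (B) and `z` of type (C). -/
theorem isLocallyArtinian_of_rsmul_X_ne_zero {V E : Type u} [AddCommGroup V]
    [Module (RingS α)ᵐᵒᵖ V] [AddCommGroup E] [Module (RingS α)ᵐᵒᵖ E] {ι : V →ₗ[(RingS α)ᵐᵒᵖ] E}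
    [IsSimpleModule (RingS α)ᵐᵒᵖ V] (hι : IsInjectiveHull ι) {v : V} (hv : v <• constS α X ≠ 0)
    (H : ∀ w z : RingS α, IsTypeB α X w → IsTypeC α X z → ∀ s, ∃ c d, s = w * c + d * z) :
    IsLocallyArtinian (RingS α)ᵐᵒᵖ E := by
  have hinj : ∀ e : E, e <• constS α X = 0 → e = 0 :=
    eq_zero_of_rsmul_X_eq_zero_of_hull α hX hι hv
  let L : Submodule (RingS α)ᵐᵒᵖ E :=
    { carrier := {y | IsArtinian (RingS α)ᵐᵒᵖ (Submodule.span (RingS α)ᵐᵒᵖ {y})}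
      zero_mem' := by
        change IsArtinian _ _
        rw [Submodule.span_zero_singleton]
        infer_instance
      add_mem' := by
        intro a b ha hb
        have ha : IsArtinian _ _ := ha
        have hb : IsArtinian _ _ := hb
        refine isArtinian_of_le (t := Submodule.span (RingS α)ᵐᵒᵖ {a} ⊔
          Submodule.span (RingS α)ᵐᵒᵖ {b}) ?_
        rw [Submodule.span_singleton_le_iff_mem]
        exact Submodule.add_mem_sup (Submodule.mem_span_singleton_self a)
          (Submodule.mem_span_singleton_self b)
      smul_mem' := by
        intro s a ha
        have ha : IsArtinian _ _ := ha
        refine isArtinian_of_le (t := Submodule.span (RingS α)ᵐᵒᵖ {a}) ?_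
        rw [Submodule.span_singleton_le_iff_mem]
        exact Submodule.smul_mem _ _ (Submodule.mem_span_singleton_self a) }
  have hmemL : ∀ y, y ∈ L ↔ IsArtinian (RingS α)ᵐᵒᵖ (Submodule.span (RingS α)ᵐᵒᵖ {y}) :=
    fun y ↦ Iff.rfl
  have hleL : ∀ (P : Submodule (RingS α)ᵐᵒᵖ E) [IsArtinian (RingS α)ᵐᵒᵖ P], P ≤ L := by
    intro P _ p hp
    exact isArtinian_of_le (t := P) ((Submodule.span_singleton_le_iff_mem _ _).2 hp)
  have hLX : ∀ e, e <• constS α X ∈ L → e ∈ L := by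
    intro e he
    have := (hmemL _).1 he
    exact hleL _ (mem_of_rsmul_X_mem α hX hinj _ (Submodule.mem_span_singleton_self _))
  have hVart : IsArtinian (RingS α)ᵐᵒᵖ V := inferInstance
  have hιL : ∀ v, ι v ∈ L := fun v ↦ hleL (LinearMap.range ι) ⟨v, rfl⟩
  have hL : L = ⊤ := by
    by_contra hne
    obtain ⟨y₀, -, hy₀⟩ := SetLike.exists_of_lt (lt_top_iff_ne_top.2 hne)
    obtain ⟨s₀, v₀, hs₀, hv₀⟩ := exists_rsmul_mem_range_of_ne_zero hι (y := y₀)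
      (fun h ↦ hy₀ (h ▸ L.zero_mem))
    obtain ⟨y, z, hy, hyz, hz, hzm, hmin⟩ := exists_irreducible_rsmul_mem α hX hk hLX
      ⟨y₀, s₀, hy₀, fun h ↦ hv₀ (hι.injective_map (by
        rw [← hs₀, h, MulOpposite.op_zero, zero_smul, map_zero])), hs₀ ▸ hιL v₀⟩
    have hPart := (hmemL _).1 hyz
    rcases Nat.eq_zero_or_pos (reduce hk α z).natDegree with hd | hd
    · exact hy (isArtinian_span_of_isArtinian_span_rsmul α hX hk hz
        ((Polynomial.Monic.natDegree_eq_zero hzm).1 hd) _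
        (Submodule.mem_span_singleton_self (y <• z)))
    · have hBz : ∀ w, IsTypeB α X w → ∀ s, ∃ c d, s = w * c + d * z := by
        intro w hw
        by_cases hzθ : z = θ _
        · rw [hzθ]
          exact exists_eq_mul_add_mul_θ α hk (hw.reduce_eq_one hk α hX)
        · exact H w z hw (IsTypeC.of_irreducible hk α hX hz hzθ hzm hd)
      set P := Submodule.span (RingS α)ᵐᵒᵖ {y <• z}
      have : Module.Finite (RingS α)ᵐᵒᵖ P := Module.Finite.iff_fg.2 (Submodule.fg_span_singleton _)
      have : IsNoetherian (RingS α)ᵐᵒᵖ P := isNoetherian_of_isNoetherianRing_of_finite _ _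
      obtain ⟨⟨p, hp⟩, hpz⟩ := exists_rsmul_eq_of_forall_isTypeB α hX hk (M := P)
        (fun m hm ↦ Subtype.ext (hinj m (congrArg Subtype.val hm))) hBz
        ⟨y <• z, Submodule.mem_span_singleton_self _⟩
      have hpz : p <• z = y <• z := congrArg Subtype.val hpz
      have hy' : y - p ∉ L := fun h ↦ hy (by simpa using L.add_mem h (hleL P hp))
      have hy'z : (y - p) <• z = 0 := by rw [smul_sub, hpz, sub_self]
      obtain ⟨s, v', hs, hv'⟩ := exists_rsmul_mem_range_of_ne_zero hι (y := y - p)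
        (fun h ↦ hy' (h ▸ L.zero_mem))
      obtain ⟨n, q, ρ, hdiv, hρ⟩ := exists_mul_pow_X_eq_mul_add α hX hz.ne_zero s
      have h1 : (y - p) <• ρ = ι v' <• constS α X ^ n := by
        rw [← hs, ← rsmul_mul, hdiv, MulOpposite.op_add, add_smul, rsmul_mul, hy'z, smul_zero,
          zero_add]
      have hρ0 : ρ = 0 := by
        by_contra hρ0
        exact (hmin (y - p) ρ hy' hρ0 (h1 ▸ L.smul_mem _ (hιL v'))).not_gt hρ
      rw [hρ0, MulOpposite.op_zero, zero_smul] at h1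
      refine hv' (hι.injective_map ?_)
      rw [map_zero]
      exact eq_zero_of_rsmul_pow_X_eq_zero α hinj n h1.symm
  intro N hN
  induction N, hN using Submodule.fg_induction with
  | singleton x => exact (hmemL x).1 (hL ▸ Submodule.mem_top)
  | sup N₁ N₂ h₁ h₂ ih₁ ih₂ => infer_instance

end TorsionFree

end

theorem mainTheorem7 {k : Type v} {R : Type u} [Field k] [CommRing R] [IsDomain R]
    [IsDiscreteValuationRing R] [Algebra k R]
    (hk : Function.Bijective (algebraMap k (IsLocalRing.ResidueField R)))
    (X : R) (hX : IsLocalRing.maximalIdeal R = Ideal.span {X})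
    (α : R ≃ₐ[k] R) (hα : ¬ IsOfFinOrder α) :
    (∀ w z : RingS α, IsTypeB α X w → IsTypeC α X z →
      List.TFAE [
        ExtOneVanishes (rightCyclic z) (rightCyclic w),
        ExtOneVanishes (leftCyclic w) (leftCyclic z),
        ExtOneVanishes (rightCyclic (toT α z)) (rightCyclic (toT α w)),
        ExtOneVanishes (leftCyclic (toT α w)) (leftCyclic (toT α z))]) ∧
    (RightDiamond (RingS α) ↔
      ∀ w z : RingS α, IsTypeB α X w → IsTypeC α X z →
        ExtOneVanishes (rightCyclic z) (rightCyclic w) ∧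
        ExtOneVanishes (leftCyclic w) (leftCyclic z) ∧
        ExtOneVanishes (rightCyclic (toT α z)) (rightCyclic (toT α w)) ∧
        ExtOneVanishes (leftCyclic (toT α w)) (leftCyclic (toT α z))) := by
  have key : ∀ w z : RingS α, IsTypeB α X w → IsTypeC α X z → _ := fun w z hw hz ↦
    extOneVanishes_iff_forall_exists_eq_add hk α hX (hw.reduce_eq_one hk α hX) hz.1.ne_zero
  refine ⟨fun w z hw hz ↦ ?_, fun hS w z hw hz ↦ ?_, fun H V E _ _ _ _ ι _ hι ↦ ?_⟩
  · obtain ⟨h1, h2, h3, h4⟩ := key w z hw hz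
    tfae_have 1 ↔ 2 := h1.trans h2.symm
    tfae_have 2 ↔ 3 := h2.trans h3.symm
    tfae_have 3 ↔ 4 := h3.trans h4.symm
    tfae_finish
  · obtain ⟨h1, h2, h3, h4⟩ := key w z hw hz
    rw [h1, h2, h3, h4, and_self, and_self, and_self]
    exact exists_eq_add_of_rightDiamond α hX hk hS hw.1 (hw.reduce_eq_one hk α hX) hz.1
      (hz.reduce hk α hX).2
  · by_cases hV : ∀ v : V, v <• constS α X = 0
    · exact isLocallyArtinian_of_rsmul_X_eq_zero α hι hX hk hV
    · push Not at hV
      obtain ⟨v, hv⟩ := hV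
      exact isLocallyArtinian_of_rsmul_X_ne_zero α hX hk hι hv fun w z hw hz ↦
        (key w z hw hz).1.1 (H w z hw hz).1
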